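/- **Model.** Let $G=(V,E)$ be a finite directed tree with a link $C\to D$ such that every node is either $C$ or an ancestor of $C$ ($k\ge C$), or $D$ or a descendant of $D$ ($k\le D$). Every $k\ge C$ has exactly one child and is either a source (no parents) or a coding point (at least two parents). Every $k\le D$ has exactly one parent and is either a receiver (no children) or a branching point (at least two children). $C$ is a coding point and $D$ is a branching point. Write $f(k)$ and $d(k)$ for the sets of parents and of children of $k$ (or for the single parent or child, when there is just one). Link $e$ works with probability $\alpha_e$, independently of the other links. Source $i$ sends the $i$-th binary unit vector, and every other node sends to its children the bit-wise XOR of the packets that reach it over working incoming links. An outcome $x=(x_a)_a$ lists the packets seen by the receivers $a$. $\Omega$ is the finite set of outcomes that can occur, and $p(x;\alpha)$ is the probability of $x$. Data are counts $n(x)\in\mathbb N$, $x\in\Omega$, with $n=\sum_{x\in\Omega} n(x)$ and $\hat p(x)=n(x)/n$. The likelihood is $\prod_{x\in\Omega}p(x;\alpha)^{n(x)}$, and $\mathcal L$ is its logarithm. An MLE is a maximizer of the likelihood over $(0,1]^E$. A solution of the likelihood equation is a point of $(0,1]^E$ at which $\mathcal L$ is finite and $\partial\mathcal L/\partial\alpha_e=0$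 for all $e\in E$. **Estimates.** For $k\ge C$, let $\hat\gamma^r_k$ be the sum of $\hat p(x)$ over the outcomes $x\in\Omega$ in which some receiver sees the probe of some source that is $k$ or an ancestor of $k$. For $k\le D$, let $\hat\gamma^m_k$ be the sum of $\hat p(x)$ over the $x\in\Omega$ in which some receiver that is $k$ or a descendant of $k$ sees a nonzero packet. Put $\hat A^r_k=\hat\gamma^r_k$ for sources and $\hat A^m_k=\hat\gamma^m_k$ for receivers. For every other $k\ge C$ (respectively $k\le D$), let $\hat A^r_k$ (respectively $\hat A^m_k$) be the solution $A\in[\hat\gamma^r_k,\infty)$ (respectively $A\in[\hat\gamma^m_k,\infty)$) of $$1-\frac{\hat\gamma^r_k}{A}=\prod_{j\in f(k)}\Bigl(1-\frac{\hat\gamma^r_j}{A}\Bigr),\qquad\text{respectively}\qquad 1-\frac{\hat\gamma^m_k}{A}=\prod_{j\in d(k)}\Bigl(1-\frac{\hat\gamma^m_j}{A}\Bigr).$$ Let $\hat\alpha\in\mathbb R^E$ have the entry $\hat A^r_k/\hat A^r_{d(k)}$ at the link that starts at $k>C$, the entry $\hat A^m_k/\hat A^m_{f(k)}$ at the link that ends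 at $k<D$, and $$\hat\alpha_{CD}=\frac{\hat A^r_C\,\hat A^m_D}{\hat\gamma^r_C}.$$ **Lemma.** (I) Suppose that $n(x)>0$ for every $x\in\Omega$. Then: 1. $\hat\gamma^r_C=\hat\gamma^m_D=1-\hat p(\mathbf 0)$, where $\mathbf 0$ is the all-zero outcome. 2. The solutions $\hat A^r_k$ and $\hat A^m_k$ above exist and are unique. 3. Every solution $\alpha$ of the likelihood equation is an MLE and has $\alpha_{CD}=\hat A^r_C\hat A^m_D/\hat\gamma^r_C$. 4. If $\hat\alpha_e\le 1$ for all $e\in E$ (so that $\hat\alpha\in(0,1]^E$), then $\hat\alpha$ solves the likelihood equation and is an MLE, and every MLE $\alpha$ has $\alpha_{CD}=\hat A^r_C\hat A^m_D/\hat\gamma^r_C$. (II) The conditions in (I) hold asymptotically: for every $\alpha\in(0,1)^E$ there is $\varepsilon>0$ such that, for all counts with $|\hat p(x)-p(x;\alpha)|<\varepsilon$ for every $x\in\Omega$, one has $n(x)>0$ for all $x\in\Omega$ and $\hat\alpha_e\le1$ for all $e\in E$. -/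

import Mathlib

open Relation Finset

/-- A directed logical tree with link `CD`: every node at or above `C` has exactly one child and is
either a source (no parent) or a coding point (at least two parents); every node at or below `D` has
exactly one parent and is either a receiver (no child) or a branching point (at least two children);
`C` is a coding point, `D` a branching point, and every node is of one of the two sorts. -/
structure TreeNetwork (V : Type*) where
  /-- `Link j k`: there is a directed link from `j` to `k`. -/
  Link : V → V → Prop
  C : V
  D : V
  isTree : (SimpleGraph.fromRel Link).IsTree
  link_CD : Link C D
  cover : ∀ k, ReflTransGen Link k C ∨ ReflTransGen Link D k
  upper_child : ∀ k, ReflTransGen Link k C → ∃! j, Link k j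
  upper_parents : ∀ k, ReflTransGen Link k C → (∀ j, ¬ Link j k) ∨ 2 ≤ {j | Link j k}.ncard
  lower_parent : ∀ k, ReflTransGen Link D k → ∃! j, Link j k
  lower_children : ∀ k, ReflTransGen Link D k → (∀ j, ¬ Link k j) ∨ 2 ≤ {j | Link k j}.ncard
  coding_C : 2 ≤ {j | Link j C}.ncard
  branching_D : 2 ≤ {j | Link D j}.ncard

namespace TreeNetwork

variable {V : Type*} (T : TreeNetwork V)

/-- `k ≥ C`: node `k` is `C` or an ancestor of `C`. -/
def Upper (k : V) : Prop := ReflTransGen T.Link k T.C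

/-- `k ≤ D`: node `k` is `D` or a descendant of `D`. -/
def Lower (k : V) : Prop := ReflTransGen T.Link T.D k

def IsSource (k : V) : Prop := ∀ j, ¬ T.Link j k

def IsReceiver (k : V) : Prop := ∀ j, ¬ T.Link k j

abbrev Source : Type _ := {k : V // T.IsSource k}

abbrev Receiver : Type _ := {k : V // T.IsReceiver k}

/-- The set `E` of links. -/
abbrev E : Type _ := {e : V × V // T.Link e.1 e.2}

/-- The link `CD`. -/
def CD : T.E := ⟨(T.C, T.D), T.link_CD⟩

theorem not_reach_D_C : ¬ ReflTransGen T.Link T.D T.C := by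
  intro h
  obtain ⟨c, _, hu⟩ := T.upper_child T.D h
  have h2 := T.branching_D
  have h1 : {j | T.Link T.D j} ⊆ {c} := fun j hj => hu j hj
  have h3 := Set.ncard_le_ncard h1 (Set.finite_singleton c)
  rw [Set.ncard_singleton] at h3
  omega

theorem acyclic (k : V) : ¬ TransGen T.Link k k := by
  intro hk
  rcases T.cover k with h | h
  · have key : TransGen T.Link T.C T.C := by
      induction h using ReflTransGen.head_induction_on with
      | refl => exact hk
      | @head a b hab hb ih =>
        apply ih
        obtain ⟨b', hab', hb'a⟩ := TransGen.head'_iff.1 hk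
        have hbb' : b' = b := (T.upper_child a (ReflTransGen.head hab hb)).unique hab' hab
        subst hbb'
        exact TransGen.tail'_iff.2 ⟨a, hb'a, hab⟩
    obtain ⟨b, hb, hbC⟩ := TransGen.head'_iff.1 key
    have : b = T.D := (T.upper_child T.C ReflTransGen.refl).unique hb T.link_CD
    subst this
    exact T.not_reach_D_C hbC
  · have key : TransGen T.Link T.D T.D := by
      induction h with
      | refl => exact hk
      | @tail b a hb hba ih =>
        apply ih
        obtain ⟨b', hab', hb'a⟩ := TransGen.tail'_iff.1 hk
        have hbb' : b' = b := (T.lower_parent a (ReflTransGen.tail hb hba)).unique hb'a hba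
        subst hbb'
        exact TransGen.head'_iff.2 ⟨a, hba, hab'⟩
    obtain ⟨b, hDb, hb⟩ := TransGen.tail'_iff.1 key
    have : b = T.C := (T.lower_parent T.D ReflTransGen.refl).unique hb T.link_CD
    subst this
    exact T.not_reach_D_C hDb

theorem wf [Finite V] : WellFounded T.Link := by
  have : Std.Irrefl (TransGen T.Link) := ⟨T.acyclic⟩
  exact Subrelation.wf (fun h => TransGen.single h)
    (Finite.wellFounded_of_trans_of_irrefl (TransGen T.Link))

noncomputable section

open scoped Classical

variable [Fintype V]

/-- The set `f(k)` of parents of `k`. -/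
def parents (k : V) : Finset V := univ.filter fun j => T.Link j k

/-- The set `d(k)` of children of `k`. -/
def children (k : V) : Finset V := univ.filter fun j => T.Link k j

/-- The packet `X_k`, a binary vector indexed by the sources, when `ω e` says whether link `e`
works: source `i` sends the `i`-th unit vector, and every other node sums (bit-wise XOR) the packets
that arrive on its working incoming links. -/
def packet (ω : T.E → Bool) : V → T.Source → ZMod 2 :=
  T.wf.fix fun k X =>
    if h : T.IsSource k then Pi.single ⟨k, h⟩ 1
    else ∑ j : {j : V // T.Link j k},
      if ω ⟨(j.1, k), j.2⟩ = true then X j.1 j.2 else 0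

theorem packet_eq (ω : T.E → Bool) (k : V) :
    T.packet ω k = if h : T.IsSource k then Pi.single ⟨k, h⟩ 1
      else ∑ j : {j : V // T.Link j k},
        if ω ⟨(j.1, k), j.2⟩ = true then T.packet ω j.1 else 0 := by
  unfold packet
  rw [WellFounded.fix_eq]

/-- One observed packet for every receiver. -/
abbrev Outcome : Type _ := T.Receiver → T.Source → ZMod 2

def outcome (ω : T.E → Bool) : T.Outcome := fun r => T.packet ω r.1

/-- The set of all outcomes that can be observed. -/
def Omega : Finset T.Outcome := univ.image T.outcome

/-- `p(x; α)`: the probability of the outcome `x` when the links work independently, link `e` with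
probability `α e`. -/
def prob (α : T.E → ℝ) (x : T.Outcome) : ℝ :=
  ∑ ω : T.E → Bool,
    if T.outcome ω = x then ∏ e, (if ω e = true then α e else 1 - α e) else 0

variable (n : T.Outcome → ℕ)

/-- The probability `∏ x, p(x; α) ^ n(x)` of the data. -/
def likelihood (α : T.E → ℝ) : ℝ := ∏ x ∈ T.Omega, T.prob α x ^ n x

def logLikelihood (α : T.E → ℝ) : ℝ := ∑ x ∈ T.Omega, (n x : ℝ) * Real.log (T.prob α x)

/-- The parameter space `(0, 1]^E`. -/
def Param : Set (T.E → ℝ) := {α | ∀ e, 0 < α e ∧ α e ≤ 1}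

/-- `α` is a maximum likelihood estimate. It is stated with the likelihood, not its logarithm, so
that the value `Real.log 0 = 0` plays no role. -/
def IsMLE (α : T.E → ℝ) : Prop := α ∈ T.Param ∧ IsMaxOn (T.likelihood n) T.Param α

/-- `α` solves the likelihood equation: the log-likelihood is finite at `α` and all its partial
derivatives exist and vanish there. -/
def SolvesLikelihoodEq (α : T.E → ℝ) : Prop :=
  α ∈ T.Param ∧ (∀ x ∈ T.Omega, 0 < T.prob α x) ∧
    ∀ e, HasDerivAt (fun t => T.logLikelihood n (Function.update α e t)) 0 (α e)

/-- The observed proportion of outcome `x`. -/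
def pHat (x : T.Outcome) : ℝ := (n x : ℝ) / ∑ y ∈ T.Omega, (n y : ℝ)

/-- `Ω^r(k)`: some receiver sees the probe of some source at or above `k`. -/
def OmegaR (k : V) : Finset T.Outcome :=
  T.Omega.filter fun x =>
    ∃ a : T.Receiver, ∃ j : T.Source, ReflTransGen T.Link j.1 k ∧ x a j ≠ 0

/-- `Ω^m(k)`: some receiver at or below `k` sees a nonzero packet. -/
def OmegaM (k : V) : Finset T.Outcome :=
  T.Omega.filter fun x => ∃ j : T.Receiver, ReflTransGen T.Link k j.1 ∧ x j ≠ 0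

def gammaR (k : V) : ℝ := ∑ x ∈ T.OmegaR k, T.pHat n x

def gammaM (k : V) : ℝ := ∑ x ∈ T.OmegaM k, T.pHat n x

/-- The equation for the estimate of the success probability from `k ≥ C` to the receiver of the
reduced reverse multicast tree. -/
def IsRootR (k : V) (A : ℝ) : Prop :=
  T.gammaR n k ≤ A ∧ 1 - T.gammaR n k / A = ∏ j ∈ T.parents k, (1 - T.gammaR n j / A)

/-- The equation for the estimate of the success probability from the source of the reduced
multicast tree to `k ≤ D`. -/
def IsRootM (k : V) (A : ℝ) : Prop :=
  T.gammaM n k ≤ A ∧ 1 - T.gammaM n k / A = ∏ j ∈ T.children k, (1 - T.gammaM n j / A)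

def AHatR (k : V) : ℝ :=
  if T.IsSource k then T.gammaR n k else Classical.epsilon (T.IsRootR n k)

def AHatM (k : V) : ℝ :=
  if T.IsReceiver k then T.gammaM n k else Classical.epsilon (T.IsRootM n k)

/-- The closed-form estimate of the success probability of link `CD`. -/
def alphaHatCD : ℝ := T.AHatR n T.C * T.AHatM n T.D / T.gammaR n T.C

/-- The vector of closed-form estimates: `Â^r_k / Â^r_{d(k)}` for the link that starts at `k > C`,
`Â^m_k / Â^m_{f(k)}` for the link that ends at `k < D`, and `alphaHatCD` for the link `CD`. -/
def alphaHat (e : T.E) : ℝ :=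
  if e = T.CD then T.alphaHatCD n
  else if T.Upper e.1.2 then T.AHatR n e.1.1 / T.AHatR n e.1.2
  else T.AHatM n e.1.2 / T.AHatM n e.1.1

end

end TreeNetwork

/-! Seen from the link `CD`, both trees point outwards, so they form one forest `Out` with the roots
`C` and `D`, and every other node `k` owns the link `lk k` to its inner neighbour. No two paths from
a source to `C` share their source, so XOR never cancels, and below `D` packets are only copied.
Hence an outcome records only which leaves are joined to `CD` by working paths, provided that `CD`
works and both roots are joined to some leaf; otherwise it is zero.

Let γ_k (`gam`) be the probability that a crossing of `k` is observed. Independence gives γ_k = A_k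
β_k, where β_k (`beta`) is the probability of a working path from `k` out to a leaf and A_k
(`reach`) that of reaching `k` from the opposite tree (`gam_eq`). The recursion for β becomes the
equation 1 - γ_k/A_k = ∏ (1 - γ_j/A_k), which has one solution A_k ≥ γ_k
(`Admissible.existsUnique`). Since A_C = α_CD β_D, A_D = α_CD β_C and γ_C = α_CD β_C β_D, the γ's
determine α_CD = A_C A_D/γ_C.

A nonzero outcome has a product probability with one local factor per node (`prob_eq`), and the zero
outcome has probability 1 - γ_C. So the log-likelihood uses the data only through the observed
totals of the γ's (`sum_mul_log_prob`). The expected score is zero; subtracting it from the observed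
score leaves a triangular system, which is solved from `CD` outwards. Thus the likelihood equation
says exactly that γ_k(α) equals the observed total for every `k`.

If α has this property, the observed proportions may be replaced by p(·; α) in the log-likelihood at
every regular parameter (`logLik_pHat_eq`), and Gibbs' inequality makes α a maximizer; its equality
case makes every other maximizer match the same totals (`likelihood_le`). The vector `alphaHat`
matches the totals by algebra alone, even when entries exceed 1 (`gam_alphaHat`). For part (II), the
roots depend continuously on the γ's, and at the true γ's the closed form returns the true α, whose
entries are below 1. -/

namespace TreeNetwork

variable {V : Type*} (T : TreeNetwork V)

/-! ### The two trees as one forest with the roots `C` and `D` -/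

/-- `j` is a neighbour of `k` on the side away from the link `CD`. -/
def Out (k j : V) : Prop := (T.Upper k ∧ T.Link j k) ∨ (T.Lower k ∧ T.Link k j)

/-- `j` is `k` or lies behind `k`, as seen from the link `CD`. -/
def Desc (k j : V) : Prop := ReflTransGen T.Out k j

/-- `k` is a source or a receiver. -/
def Leaf (k : V) : Prop := ∀ j, ¬ T.Out k j

variable {T}

theorem upper_C : T.Upper T.C := ReflTransGen.refl

theorem lower_D : T.Lower T.D := ReflTransGen.refl

theorem Upper.not_lower {k : V} (h : T.Upper k) : ¬ T.Lower k :=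
  fun h' => T.not_reach_D_C (ReflTransGen.trans h' h)

theorem Lower.not_upper {k : V} (h : T.Lower k) : ¬ T.Upper k := fun h' => h'.not_lower h

theorem lower_of_not_upper {k : V} (h : ¬ T.Upper k) : T.Lower k := (T.cover k).resolve_left h

theorem Upper.out_iff {k j : V} (h : T.Upper k) : T.Out k j ↔ T.Link j k := by
  simp [Out, h, h.not_lower]

theorem Lower.out_iff {k j : V} (h : T.Lower k) : T.Out k j ↔ T.Link k j := by
  simp [Out, h, h.not_upper]

theorem Upper.out {k j : V} (h : T.Upper k) (hj : T.Out k j) : T.Upper j :=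
  ReflTransGen.head (h.out_iff.1 hj) h

theorem Lower.out {k j : V} (h : T.Lower k) (hj : T.Out k j) : T.Lower j :=
  ReflTransGen.tail h (h.out_iff.1 hj)

theorem Out.upper_iff {k j : V} (h : T.Out k j) : T.Upper j ↔ T.Upper k := by
  by_cases hk : T.Upper k
  · simp [hk, hk.out h]
  · simp [hk, ((lower_of_not_upper hk).out h).not_upper]

theorem Desc.upper_iff {k j : V} (h : T.Desc k j) : T.Upper j ↔ T.Upper k := by
  induction h with
  | refl => rfl
  | tail _ h ih => rw [h.upper_iff, ih]

theorem not_out_C {k : V} : ¬ T.Out k T.C := by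
  intro h
  have hk : T.Upper k := h.upper_iff.1 upper_C
  have := (T.upper_child T.C upper_C).unique (hk.out_iff.1 h) T.link_CD
  subst this
  exact hk.not_lower lower_D

theorem not_out_D {k : V} : ¬ T.Out k T.D := by
  intro h
  by_cases hk : T.Upper k
  · exact (hk.out h).not_lower lower_D
  · have hk := lower_of_not_upper hk
    have := (T.lower_parent T.D lower_D).unique (hk.out_iff.1 h) T.link_CD
    subst this
    exact hk.not_upper upper_C

theorem Out.unique {k k' j : V} (h : T.Out k j) (h' : T.Out k' j) : k = k' := by
  by_cases hj : T.Upper j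
  · have hk := h.upper_iff.1 hj
    have hk' := h'.upper_iff.1 hj
    exact (T.upper_child j hj).unique (hk.out_iff.1 h) (hk'.out_iff.1 h')
  · have hk := lower_of_not_upper (mt h.upper_iff.2 hj)
    have hk' := lower_of_not_upper (mt h'.upper_iff.2 hj)
    exact (T.lower_parent j (lower_of_not_upper hj)).unique (hk.out_iff.1 h) (hk'.out_iff.1 h')

theorem exists_out_iff {k : V} : (∃ p, T.Out p k) ↔ k ≠ T.C ∧ k ≠ T.D := by
  constructor
  · rintro ⟨p, h⟩
    exact ⟨fun e => not_out_C (e ▸ h), fun e => not_out_D (e ▸ h)⟩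
  · rintro ⟨hC, hD⟩
    rcases T.cover k with h | h
    · rcases ReflTransGen.cases_head h with h | ⟨p, hp, hpC⟩
      · exact absurd h hC
      · exact ⟨p, (show T.Upper p from hpC).out_iff.2 hp⟩
    · rcases ReflTransGen.cases_tail h with h | ⟨p, hDp, hp⟩
      · exact absurd h hD
      · exact ⟨p, (show T.Lower p from hDp).out_iff.2 hp⟩

theorem transGen_link_of_transGen_out {k j : V} (h : TransGen T.Out k j) :
    TransGen T.Link j k ∨ TransGen T.Link k j := by
  by_cases hk : T.Upper k
  · left
    induction h with
    | single h => exact TransGen.single (hk.out_iff.1 h)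
    | @tail b c hb h ih =>
      have hb : T.Upper b := (Desc.upper_iff (T := T) hb.to_reflTransGen).2 hk
      exact TransGen.head (hb.out_iff.1 h) ih
  · right
    induction h with
    | single h => exact TransGen.single ((lower_of_not_upper hk).out_iff.1 h)
    | @tail b c hb h ih =>
      have hb : ¬ T.Upper b := mt (Desc.upper_iff (T := T) hb.to_reflTransGen).1 hk
      exact TransGen.tail ih ((lower_of_not_upper hb).out_iff.1 h)

theorem not_transGen_out (k : V) : ¬ TransGen T.Out k k := fun h =>
  T.acyclic k ((transGen_link_of_transGen_out h).elim id id)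

/-- Induction from the roots `C` and `D` outwards. -/
theorem wf_out [Finite V] : WellFounded T.Out := by
  have : Std.Irrefl (TransGen T.Out) := ⟨not_transGen_out⟩
  exact Subrelation.wf (fun h => TransGen.single h)
    (Finite.wellFounded_of_trans_of_irrefl (TransGen T.Out))

/-- Induction from the leaves inwards. -/
theorem wf_out_swap [Finite V] : WellFounded (fun j k => T.Out k j) := by
  have : Std.Irrefl (TransGen (Function.swap T.Out)) :=
    ⟨fun k h => not_transGen_out (T := T) k (transGen_swap.1 h)⟩
  exact Subrelation.wf (r := TransGen (Function.swap T.Out)) (fun h => TransGen.single h)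
    (Finite.wellFounded_of_trans_of_irrefl _)

theorem Upper.leaf_iff {k : V} (h : T.Upper k) : T.Leaf k ↔ T.IsSource k := by
  simp [Leaf, IsSource, h.out_iff]

theorem Lower.leaf_iff {k : V} (h : T.Lower k) : T.Leaf k ↔ T.IsReceiver k := by
  simp [Leaf, IsReceiver, h.out_iff]

theorem IsSource.upper {k : V} (h : T.IsSource k) : T.Upper k := by
  by_contra hk
  obtain ⟨p, hp, -⟩ := T.lower_parent k (lower_of_not_upper hk)
  exact h p hp

theorem IsReceiver.lower {k : V} (h : T.IsReceiver k) : T.Lower k := by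
  by_contra hk
  obtain ⟨p, hp, -⟩ := T.upper_child k ((T.cover k).resolve_right hk)
  exact h p hp

theorem Upper.desc_iff {k j : V} (h : T.Upper k) : T.Desc k j ↔ ReflTransGen T.Link j k := by
  constructor
  · intro hd
    induction hd with
    | refl => exact .refl
    | @tail b c hb hbc ih =>
      exact ReflTransGen.head ((((Desc.upper_iff (T := T) hb).2 h).out_iff).1 hbc) ih
  · intro hd
    induction hd using ReflTransGen.head_induction_on with
    | refl => exact .refl
    | @head a b hab hb ih =>
      exact ReflTransGen.tail ih ((((Desc.upper_iff (T := T) ih).2 h).out_iff).2 hab)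

theorem Lower.desc_iff {k j : V} (h : T.Lower k) : T.Desc k j ↔ ReflTransGen T.Link k j := by
  constructor
  · intro hd
    induction hd with
    | refl => exact .refl
    | @tail b c hb hbc ih =>
      have := lower_of_not_upper (mt (Desc.upper_iff (T := T) hb).1 h.not_upper)
      exact ReflTransGen.tail ih (this.out_iff.1 hbc)
  · intro hd
    induction hd with
    | refl => exact .refl
    | @tail b c hb hbc ih =>
      have := lower_of_not_upper (mt (Desc.upper_iff (T := T) ih).1 h.not_upper)
      exact ReflTransGen.tail ih (this.out_iff.2 hbc)

theorem two_le_ncard_out [Finite V] {k : V} (h : ¬ T.Leaf k) : 2 ≤ {j | T.Out k j}.ncard := by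
  by_cases hk : T.Upper k
  · simp_rw [hk.out_iff]
    exact (T.upper_parents k hk).resolve_left (mt hk.leaf_iff.2 h)
  · have hk := lower_of_not_upper hk
    simp_rw [hk.out_iff]
    exact (T.lower_children k hk).resolve_left (mt hk.leaf_iff.2 h)

theorem Desc.total {i j k : V} (hi : T.Desc i k) (hj : T.Desc j k) : T.Desc i j ∨ T.Desc j i := by
  have := ReflTransGen.total_of_right_unique (r := Function.swap T.Out)
    (fun a b c hab hac => Out.unique hab hac) (reflTransGen_swap.2 hi) (reflTransGen_swap.2 hj)
  exact (this.imp reflTransGen_swap.1 reflTransGen_swap.1).symm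

/-- If `i` lies strictly behind `j`, then so does, or equals `j`, the inner neighbour of `i`. -/
theorem Desc.of_out {i j p : V} (h : T.Desc j i) (hne : i ≠ j) (hp : T.Out p i) : T.Desc j p := by
  rcases ReflTransGen.cases_tail h with e | ⟨b, hb, hbi⟩
  · exact absurd e hne
  · rwa [hp.unique hbi]

/-- The subtrees behind distinct neighbours of `k` are disjoint: otherwise one would contain the
other, hence also contain `k`, which closes a cycle. -/
theorem eq_of_out_of_desc {k j j' i : V} (h : T.Out k j) (h' : T.Out k j') (hi : T.Desc j i)
    (hi' : T.Desc j' i) : j = j' := by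
  have key : ∀ {a b : V}, T.Out k a → T.Out k b → T.Desc a b → a = b := by
    intro a b ha hb hab
    by_contra hne
    exact not_transGen_out k (TransGen.head' ha (hab.of_out (Ne.symm hne) hb))
  rcases hi.total hi' with h1 | h1
  · exact key h h' h1
  · exact (key h' h h1).symm

theorem exists_leaf [Finite V] (k : V) : ∃ l, T.Leaf l ∧ T.Desc k l := by
  induction k using (wf_out_swap (T := T)).induction with
  | _ k ih =>
    by_cases hk : T.Leaf k
    · exact ⟨k, hk, .refl⟩
    · simp only [Leaf, not_forall, not_not] at hk
      obtain ⟨j, hj⟩ := hk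
      obtain ⟨l, hl, hjl⟩ := ih j hj
      exact ⟨l, hl, ReflTransGen.head hj hjl⟩

noncomputable section

open scoped Classical

/-! ### The two roots, and the labelling of links by nodes. -/

variable (T)

/-- The root, `C` or `D`, of the tree that contains `k`. -/
def root (k : V) : V := if T.Upper k then T.C else T.D

/-- The root of the tree that does not contain `k`. -/
def opp (k : V) : V := if T.Upper k then T.D else T.C

variable {T}

theorem Desc.root_eq {k j : V} (h : T.Desc k j) : T.root j = T.root k := by
  simp [root, h.upper_iff]

theorem Desc.opp_eq {k j : V} (h : T.Desc k j) : T.opp j = T.opp k := by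
  simp [opp, h.upper_iff]

theorem Out.root_eq {k j : V} (h : T.Out k j) : T.root j = T.root k := by
  simp [root, h.upper_iff]

theorem Out.opp_eq {k j : V} (h : T.Out k j) : T.opp j = T.opp k := by
  simp [opp, h.upper_iff]

@[simp] theorem root_C : T.root T.C = T.C := by simp [root, upper_C]

@[simp] theorem root_D : T.root T.D = T.D := by simp [root, lower_D.not_upper]

@[simp] theorem opp_C : T.opp T.C = T.D := by simp [opp, upper_C]

@[simp] theorem opp_D : T.opp T.D = T.C := by simp [opp, lower_D.not_upper]

theorem desc_root (k : V) : T.Desc (T.root k) k := by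
  unfold root
  split_ifs with h
  · exact upper_C.desc_iff.2 h
  · exact lower_D.desc_iff.2 (lower_of_not_upper h)

theorem not_out_root {k i : V} : ¬ T.Out k (T.root i) := by
  unfold root
  split_ifs
  · exact not_out_C
  · exact not_out_D

theorem not_desc_opp {k i : V} (h : T.Desc (T.opp k) i) : ¬ T.Desc (T.root k) i := by
  intro h'
  have h1 := h.upper_iff.symm.trans h'.upper_iff
  unfold root opp at h1
  split_ifs at h1 <;> simp [upper_C, lower_D.not_upper] at h1

variable (T)

/-- The link between `k` and its inner neighbour; the link `CD` if `k` is `C` or `D`. -/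
def lk (k : V) : T.E :=
  if h : ∃ p, T.Upper p ∧ T.Link k p then ⟨(k, h.choose), h.choose_spec.2⟩
  else if h : ∃ p, T.Lower p ∧ T.Link p k then ⟨(h.choose, k), h.choose_spec.2⟩
  else T.CD

variable {T}

theorem Out.lk_eq_of_upper {p k : V} (h : T.Out p k) (hp : T.Upper p) :
    T.lk k = ⟨(k, p), hp.out_iff.1 h⟩ := by
  have hex : ∃ p, T.Upper p ∧ T.Link k p := ⟨p, hp, hp.out_iff.1 h⟩
  have : hex.choose = p :=
    Out.unique (hex.choose_spec.1.out_iff.2 hex.choose_spec.2) h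
  simp [lk, hex, this]

theorem Out.lk_eq_of_lower {p k : V} (h : T.Out p k) (hp : T.Lower p) :
    T.lk k = ⟨(p, k), hp.out_iff.1 h⟩ := by
  have hex : ∃ p, T.Lower p ∧ T.Link p k := ⟨p, hp, hp.out_iff.1 h⟩
  have hno : ¬ ∃ p, T.Upper p ∧ T.Link k p := by
    rintro ⟨q, hq, hqk⟩
    exact (hp.out h).not_upper (hq.out (hq.out_iff.2 hqk))
  have : hex.choose = p :=
    Out.unique (hex.choose_spec.1.out_iff.2 hex.choose_spec.2) h
  simp [lk, hno, hex, this]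

theorem lk_of_root {k : V} (h : ∀ p, ¬ T.Out p k) : T.lk k = T.CD := by
  have h1 : ¬ ∃ p, T.Upper p ∧ T.Link k p := by
    rintro ⟨q, hq, hqk⟩
    exact h q (hq.out_iff.2 hqk)
  have h2 : ¬ ∃ p, T.Lower p ∧ T.Link p k := by
    rintro ⟨q, hq, hqk⟩
    exact h q (hq.out_iff.2 hqk)
  simp [lk, h1, h2]

@[simp] theorem lk_C : T.lk T.C = T.CD := lk_of_root fun _ => not_out_C

@[simp] theorem lk_D : T.lk T.D = T.CD := lk_of_root fun _ => not_out_D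

theorem Out.lk_ne_CD {p k : V} (h : T.Out p k) : T.lk k ≠ T.CD := by
  intro e
  by_cases hp : T.Upper p
  · rw [h.lk_eq_of_upper hp, CD, Subtype.mk.injEq, Prod.mk.injEq] at e
    exact not_out_C (e.1 ▸ h)
  · rw [h.lk_eq_of_lower (lower_of_not_upper hp), CD, Subtype.mk.injEq, Prod.mk.injEq] at e
    exact not_out_D (e.2 ▸ h)

theorem Out.lk_inj {p k k' : V} (h : T.Out p k) (e : T.lk k = T.lk k') : k = k' := by
  by_cases h' : ∃ q, T.Out q k'
  · obtain ⟨q, hq⟩ := h'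
    by_cases hp : T.Upper p <;> by_cases hq' : T.Upper q
    · rw [h.lk_eq_of_upper hp, hq.lk_eq_of_upper hq', Subtype.mk.injEq, Prod.mk.injEq] at e
      exact e.1
    · have hq' := lower_of_not_upper hq'
      rw [h.lk_eq_of_upper hp, hq.lk_eq_of_lower hq', Subtype.mk.injEq, Prod.mk.injEq] at e
      exact absurd (hp.out h) (e.1 ▸ hq'.not_upper)
    · have hp := lower_of_not_upper hp
      rw [h.lk_eq_of_lower hp, hq.lk_eq_of_upper hq', Subtype.mk.injEq, Prod.mk.injEq] at e
      exact absurd (hq'.out hq) (e.1 ▸ hp.not_upper)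
    · have hp := lower_of_not_upper hp
      have hq' := lower_of_not_upper hq'
      rw [h.lk_eq_of_lower hp, hq.lk_eq_of_lower hq', Subtype.mk.injEq, Prod.mk.injEq] at e
      exact e.2
  · push Not at h'
    exact absurd (e.trans (lk_of_root h')) h.lk_ne_CD

/-- With `Out.lk_inj`, this indexes the links by `CD` and the nodes other than `C` and `D`. -/
theorem eq_CD_or_exists_lk (e : T.E) : e = T.CD ∨ ∃ p k, T.Out p k ∧ e = T.lk k := by
  obtain ⟨⟨a, b⟩, h⟩ := e
  by_cases hb : T.Upper b
  · right
    have ho : T.Out b a := hb.out_iff.2 h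
    exact ⟨b, a, ho, (ho.lk_eq_of_upper hb).symm⟩
  · have hb := lower_of_not_upper hb
    rcases ReflTransGen.cases_tail hb with e | ⟨p, hp, hpb⟩
    · left
      subst e
      have := (T.lower_parent T.D lower_D).unique h T.link_CD
      simp only at this
      subst this
      rfl
    · right
      have := (T.lower_parent b hb).unique h hpb
      simp only at this
      subst this
      have hp : T.Lower a := hp
      have ho : T.Out a b := hp.out_iff.2 h
      exact ⟨a, b, ho, (ho.lk_eq_of_lower hp).symm⟩

/-! ### Working paths and outcomes -/

variable (T)

/-- All links of the path from `k` outwards to `j` work. -/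
def Open (ω : T.E → Bool) (k j : V) : Prop :=
  ReflTransGen (fun a b => T.Out a b ∧ ω (T.lk b) = true) k j

/-- A working path leads from `k` outwards to some leaf. -/
def OpenLeaf (ω : T.E → Bool) (k : V) : Prop := ∃ l, T.Leaf l ∧ T.Open ω k l

/-- A working path leads from the root of the tree of `k` through `k` to some leaf. -/
def Hit (ω : T.E → Bool) (k : V) : Prop := T.Open ω (T.root k) k ∧ T.OpenLeaf ω k

variable {T} {ω ω' : T.E → Bool}

theorem Open.desc {k j : V} (h : T.Open ω k j) : T.Desc k j := by
  induction h with
  | refl => exact .refl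
  | tail _ h ih => exact ReflTransGen.tail ih h.1

theorem Open.trans {i j k : V} (h : T.Open ω i j) (h' : T.Open ω j k) : T.Open ω i k :=
  ReflTransGen.trans h h'

theorem open_iff_of_out {i p k : V} (h : T.Out p k) (hne : k ≠ i) :
    T.Open ω i k ↔ T.Open ω i p ∧ ω (T.lk k) = true := by
  constructor
  · intro ho
    rcases ReflTransGen.cases_tail ho with e | ⟨b, hb, hbk⟩
    · exact absurd e hne
    · rw [h.unique hbk.1]; exact ⟨hb, hbk.2⟩
  · rintro ⟨h1, h2⟩
    exact ReflTransGen.tail h1 ⟨h, h2⟩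

theorem Open.of_desc {i j k : V} (h : T.Open ω i k) (hij : T.Desc i j) (hjk : T.Desc j k) :
    T.Open ω i j ∧ T.Open ω j k := by
  induction hjk with
  | refl => exact ⟨h, .refl⟩
  | @tail b c hb hbc ih =>
    have hne : c ≠ i := by
      rintro rfl
      exact not_transGen_out c (TransGen.tail' (ReflTransGen.trans hij hb) hbc)
    rw [open_iff_of_out hbc hne] at h
    obtain ⟨h1, h2⟩ := ih h.1
    exact ⟨h1, ReflTransGen.tail h2 ⟨hbc, h.2⟩⟩

/-- Only the links on the path itself matter. The independence statements below rest on this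
locality. -/
theorem Open.congr {k j : V} (h : T.Open ω k j)
    (hω : ∀ p i, T.Desc k p → T.Out p i → T.Desc i j → ω (T.lk i) = ω' (T.lk i)) :
    T.Open ω' k j := by
  induction h with
  | refl => exact .refl
  | @tail b c hb hbc ih =>
    refine ReflTransGen.tail (ih fun p i hp hpi hi => hω p i hp hpi (ReflTransGen.tail hi hbc.1))
      ⟨hbc.1, ?_⟩
    rw [← hω b c (Open.desc hb) hbc.1 .refl]
    exact hbc.2

theorem openLeaf_iff {k : V} (h : ¬ T.Leaf k) :
    T.OpenLeaf ω k ↔ ∃ j, T.Out k j ∧ ω (T.lk j) = true ∧ T.OpenLeaf ω j := by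
  constructor
  · rintro ⟨l, hl, hkl⟩
    rcases ReflTransGen.cases_head hkl with e | ⟨b, hb, hbl⟩
    · exact absurd (e ▸ hl) h
    · exact ⟨b, hb.1, hb.2, l, hl, hbl⟩
  · rintro ⟨j, hj, hω, l, hl, hjl⟩
    exact ⟨l, hl, ReflTransGen.head ⟨hj, hω⟩ hjl⟩

theorem Leaf.openLeaf {k : V} (h : T.Leaf k) : T.OpenLeaf ω k := ⟨k, h, .refl⟩

theorem hit_iff {k : V} :
    T.Hit ω k ↔ ∃ l, T.Leaf l ∧ T.Desc k l ∧ T.Open ω (T.root k) l := by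
  constructor
  · rintro ⟨h, l, hl, hkl⟩
    exact ⟨l, hl, hkl.desc, h.trans hkl⟩
  · rintro ⟨l, hl, hkl, h⟩
    obtain ⟨h1, h2⟩ := h.of_desc (desc_root k) hkl
    exact ⟨h1, l, hl, h2⟩

theorem Hit.of_desc {j k : V} (h : T.Desc j k) (hk : T.Hit ω k) : T.Hit ω j := by
  rw [hit_iff] at *
  obtain ⟨l, hl, hkl, ho⟩ := hk
  exact ⟨l, hl, ReflTransGen.trans h hkl, h.root_eq ▸ ho⟩

variable [Fintype V]

/-- Evaluates an XOR in which at most one summand is nonzero. -/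
theorem sum_ite_eq_ite_exists {ι R : Type*} [Fintype ι] [AddCommMonoid R] {P : ι → Prop}
    [DecidablePred P] [Decidable (∃ i, P i)] (hP : ∀ i j, P i → P j → i = j) (c : R) :
    ∑ i, (if P i then c else 0) = if ∃ i, P i then c else 0 := by
  by_cases h : ∃ i, P i
  · obtain ⟨i, hi⟩ := h
    rw [if_pos ⟨i, hi⟩, Finset.sum_eq_single i, if_pos hi]
    · intro j _ hj
      exact if_neg fun h => hj (hP _ _ h hi)
    · simp
  · rw [if_neg h]
    push Not at h
    exact Finset.sum_eq_zero fun i _ => if_neg (h i)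

/-- A source lies behind at most one parent of `k`, so no two arriving packets share a coordinate
and XOR acts as a disjoint union. -/
theorem packet_upper (ω : T.E → Bool) (k : V) (hk : T.Upper k) (s : T.Source) :
    T.packet ω k s = if T.Open ω k s then 1 else 0 := by
  induction k using T.wf.induction with
  | _ k ih =>
    rw [T.packet_eq]
    split_ifs with h1 h2 h2
    · have : s = ⟨k, h1⟩ := by
        rcases ReflTransGen.cases_head h2 with e | ⟨b, hb, -⟩
        · exact Subtype.ext e.symm
        · exact absurd hb.1 (hk.leaf_iff.2 h1 b)
      simp [this]
    · rw [Pi.single_eq_of_ne]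
      rintro rfl
      exact h2 .refl
    all_goals
      have e : ∀ j : {j : V // T.Link j k},
          (if ω ⟨(j.1, k), j.2⟩ = true then T.packet ω j.1 else 0) s =
            if ω (T.lk j.1) = true ∧ T.Open ω j.1 s then 1 else 0 := by
        intro j
        have ho : T.Out k j.1 := hk.out_iff.2 j.2
        rw [ho.lk_eq_of_upper hk]
        have := ih j.1 j.2 (hk.out ho)
        split_ifs <;> simp_all
      have hP : ∀ i j : {j : V // T.Link j k}, (ω (T.lk i.1) = true ∧ T.Open ω i.1 s) →
          (ω (T.lk j.1) = true ∧ T.Open ω j.1 s) → i = j := by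
        rintro i j ⟨-, hi⟩ ⟨-, hj⟩
        exact Subtype.ext (eq_of_out_of_desc (hk.out_iff.2 i.2) (hk.out_iff.2 j.2) hi.desc hj.desc)
      rw [Finset.sum_apply, Finset.sum_congr rfl fun j _ => e j,
        sum_ite_eq_ite_exists (P := fun j : {j : V // T.Link j k} =>
          ω (T.lk j.1) = true ∧ T.Open ω j.1 s) hP]
    · rw [if_pos]
      rcases ReflTransGen.cases_head h2 with e | ⟨b, hb, hbl⟩
      · exact absurd (e ▸ s.2) h1
      · exact ⟨⟨b, hk.out_iff.1 hb.1⟩, hb.2, hbl⟩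
    · rw [if_neg]
      rintro ⟨j, hω, hj⟩
      exact h2 (ReflTransGen.head ⟨hk.out_iff.2 j.2, hω⟩ hj)

/-- Below `D` every node has a single parent and merely forwards the packet of `C`. -/
theorem packet_lower (ω : T.E → Bool) (k : V) (hk : T.Lower k) :
    T.packet ω k = if ω T.CD = true ∧ T.Open ω T.D k then T.packet ω T.C else 0 := by
  induction k using T.wf.induction with
  | _ k ih =>
    obtain ⟨p, hp, hu⟩ := T.lower_parent k hk
    have hs : ¬ T.IsSource k := fun h => h p hp
    rw [T.packet_eq, dif_neg hs]
    have : Unique {j // T.Link j k} := ⟨⟨⟨p, hp⟩⟩, fun j => Subtype.ext (hu _ j.2)⟩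
    rw [Fintype.sum_eq_single ⟨p, hp⟩ (fun j hj => absurd (Subtype.ext (hu _ j.2)) hj)]
    by_cases hD : k = T.D
    · subst hD
      have : p = T.C := (T.lower_parent T.D lower_D).unique hp T.link_CD
      subst this
      have : T.Open ω T.D T.D := .refl
      simp [this, CD]
    · have hC : k ≠ T.C := fun h => hk.not_upper (h ▸ upper_C)
      obtain ⟨q, hq⟩ := exists_out_iff.2 ⟨hC, hD⟩
      have hql : T.Lower q := lower_of_not_upper (mt hq.upper_iff.2 hk.not_upper)
      obtain rfl : q = p := hu _ (hql.out_iff.1 hq)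
      rw [open_iff_of_out hq hD, hq.lk_eq_of_lower hql, ih q hp hql]
      split_ifs <;> simp_all

theorem outcome_apply (ω : T.E → Bool) (a : T.Receiver) (s : T.Source) :
    T.outcome ω a s = if ω T.CD = true ∧ T.Open ω T.D a ∧ T.Open ω T.C s then 1 else 0 := by
  rw [outcome, packet_lower ω a (IsReceiver.lower a.2)]
  split_ifs with h1 h2 h2
  · simp [packet_upper ω T.C upper_C, h2.2.2]
  · simp only [packet_upper ω T.C upper_C, ite_eq_right_iff]
    exact fun h => absurd ⟨h1.1, h1.2, h⟩ h2
  · exact absurd ⟨h2.1, h2.2.1⟩ h1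
  · rfl

/-! ### The sets of outcomes that certify a crossing. -/

variable (T)

/-- The outcomes that show that a probe crossed `k`. -/
def OmegaAt (k : V) : Finset T.Outcome := if T.Upper k then T.OmegaR k else T.OmegaM k

variable {T}

theorem omegaAt_subset (k : V) : T.OmegaAt k ⊆ T.Omega := by
  unfold OmegaAt
  split_ifs
  · exact Finset.filter_subset _ _
  · exact Finset.filter_subset _ _

theorem outcome_mem_omega (ω : T.E → Bool) : T.outcome ω ∈ T.Omega :=
  Finset.mem_image_of_mem _ (Finset.mem_univ _)

/-- A nonzero entry of an outcome needs `CD` and both of its paths, to a source and to a receiver.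
One of these ends lies behind `k`; the other is any leaf of the opposite tree. -/
theorem outcome_mem_omegaAt (ω : T.E → Bool) (k : V) :
    T.outcome ω ∈ T.OmegaAt k ↔ ω T.CD = true ∧ T.Hit ω k ∧ T.Hit ω (T.opp k) := by
  unfold OmegaAt
  simp only [hit_iff]
  split_ifs with hk
  · simp only [OmegaR, Finset.mem_filter, outcome_mem_omega, true_and, outcome_apply, opp, root, hk,
      if_true, lower_D.not_upper, if_false, ne_eq, ite_eq_right_iff, one_ne_zero, imp_false,
      not_not]
    constructor
    · rintro ⟨a, j, hj, h1, h2, h3⟩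
      exact ⟨h1, ⟨j, (IsSource.upper j.2).leaf_iff.2 j.2, hk.desc_iff.2 hj, h3⟩,
        a, (IsReceiver.lower a.2).leaf_iff.2 a.2, h2.desc, h2⟩
    · rintro ⟨h1, ⟨j, hj, hkj, h3⟩, a, ha, hDa, h2⟩
      have ha' : T.IsReceiver a :=
        (lower_of_not_upper (mt hDa.upper_iff.1 lower_D.not_upper)).leaf_iff.1 ha
      have hj' : T.IsSource j := (hkj.upper_iff.2 hk).leaf_iff.1 hj
      exact ⟨⟨a, ha'⟩, ⟨j, hj'⟩, hk.desc_iff.1 hkj, h1, h2, h3⟩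
  · have hk' := lower_of_not_upper hk
    simp only [OmegaM, Finset.mem_filter, outcome_mem_omega, true_and, opp, root, hk, if_false,
      upper_C, if_true, Function.ne_iff, outcome_apply, Pi.zero_apply, ne_eq, ite_eq_right_iff,
      one_ne_zero, imp_false, not_not]
    constructor
    · rintro ⟨a, ha, j, h1, h2, h3⟩
      exact ⟨h1, ⟨a, (IsReceiver.lower a.2).leaf_iff.2 a.2, hk'.desc_iff.2 ha, h2⟩,
        j, (IsSource.upper j.2).leaf_iff.2 j.2, h3.desc, h3⟩
    · rintro ⟨h1, ⟨a, ha, hka, h2⟩, j, hj, hCj, h3⟩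
      have ha' : T.IsReceiver a :=
        (lower_of_not_upper (mt hka.upper_iff.1 hk)).leaf_iff.1 ha
      have hj' : T.IsSource j := (hCj.upper_iff.2 upper_C).leaf_iff.1 hj
      exact ⟨⟨a, ha'⟩, hk'.desc_iff.1 hka, ⟨j, hj'⟩, h1, h2, h3⟩

theorem mem_omega {x : T.Outcome} : x ∈ T.Omega ↔ ∃ ω, T.outcome ω = x := by
  simp [Omega]

theorem omegaAt_mono {j k : V} (h : T.Desc j k) : T.OmegaAt k ⊆ T.OmegaAt j := by
  intro x hx
  obtain ⟨ω, rfl⟩ := mem_omega.1 (omegaAt_subset k hx)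
  rw [outcome_mem_omegaAt] at *
  exact ⟨hx.1, hx.2.1.of_desc h, h.opp_eq ▸ hx.2.2⟩

/-- The description by working links is symmetric in the two trees; this gives the equality of the
two estimates at `C` and `D`. -/
theorem omegaAt_C_eq : T.OmegaAt T.C = T.OmegaAt T.D := by
  ext x
  by_cases hx : x ∈ T.Omega
  · obtain ⟨ω, rfl⟩ := mem_omega.1 hx
    simp only [outcome_mem_omegaAt, opp_C, opp_D]
    tauto
  · exact ⟨fun h => absurd (omegaAt_subset _ h) hx, fun h => absurd (omegaAt_subset _ h) hx⟩

theorem omegaAt_root_subset (k : V) : T.OmegaAt k ⊆ T.OmegaAt T.C := by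
  have := omegaAt_mono (desc_root (T := T) k)
  unfold root at this
  split_ifs at this
  · exact this
  · rwa [omegaAt_C_eq]

theorem mem_omegaAt_C {x : T.Outcome} (hx : x ∈ T.Omega) : x ∈ T.OmegaAt T.C ↔ x ≠ 0 := by
  rw [omegaAt_C_eq]
  have h : ∀ j : T.Receiver, ReflTransGen T.Link T.D j := fun j => IsReceiver.lower j.2
  simp [OmegaAt, lower_D.not_upper, OmegaM, hx, h, Function.ne_iff]

end

noncomputable section

open scoped Classical

/-! ### Expectations over independent Bernoulli variables -/

section Expectation

variable {ι : Type*} [Fintype ι]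

/-- The weight of `ω` when the coordinates are independent, coordinate `i` being true with weight
`α i`. -/
def weight (α : ι → ℝ) (ω : ι → Bool) : ℝ := ∏ i, (if ω i = true then α i else 1 - α i)

/-- The expectation of `f`. -/
def expect (α : ι → ℝ) (f : (ι → Bool) → ℝ) : ℝ := ∑ ω, f ω * weight α ω

theorem sum_weight (α : ι → ℝ) : ∑ ω, weight α ω = 1 := by
  have := Finset.prod_univ_sum (fun _ : ι => (Finset.univ : Finset Bool))
    (fun i b => if b = true then α i else 1 - α i)
  rw [Fintype.piFinset_univ] at this
  unfold weight
  rw [← this]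
  simp

theorem expect_const (α : ι → ℝ) (c : ℝ) : expect α (fun _ => c) = c := by
  simp [expect, ← Finset.mul_sum, sum_weight]

theorem expect_one_sub (α : ι → ℝ) (f : (ι → Bool) → ℝ) :
    expect α (fun ω => 1 - f ω) = 1 - expect α f := by
  simp only [expect, sub_mul, one_mul, Finset.sum_sub_distrib, sum_weight]

/-- This is a polynomial identity, valid for all real `α`; later it is applied to `alphaHat`, whose
entries may exceed 1. -/
theorem expect_mul (α : ι → ℝ) {f g : (ι → Bool) → ℝ} {A B : Set ι} (hf : DependsOn f A)
    (hg : DependsOn g B) (hAB : Disjoint A B) :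
    expect α (fun ω => f ω * g ω) = expect α f * expect α g := by
  -- Exchanging the coordinates outside `A` between two independent copies is a weight-preserving
  -- involution of pairs. It leaves `f p.1` alone and turns `g p.1` into `g p.2`.
  let mix : (ι → Bool) × (ι → Bool) → (ι → Bool) × (ι → Bool) := fun p =>
    (fun i => if i ∈ A then p.1 i else p.2 i, fun i => if i ∈ A then p.2 i else p.1 i)
  have hmix : Function.Involutive mix := by
    rintro ⟨a, b⟩
    ext i <;> by_cases hi : i ∈ A <;> simp [mix, hi]
  have hw : ∀ p, weight α (mix p).1 * weight α (mix p).2 = weight α p.1 * weight α p.2 := by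
    intro p
    simp only [weight, ← Finset.prod_mul_distrib]
    refine Finset.prod_congr rfl fun i _ => ?_
    by_cases hi : i ∈ A <;> simp [mix, hi, mul_comm]
  have h1 : ∀ p, f (mix p).1 = f p.1 := fun p => hf fun i hi => by simp [mix, hi]
  have h2 : ∀ p, g (mix p).1 = g p.2 := fun p => hg fun i hi => by
    simp [mix, Set.disjoint_right.1 hAB hi]
  calc expect α (fun ω => f ω * g ω)
      = (∑ ω, f ω * g ω * weight α ω) * ∑ ω, weight α ω := by rw [sum_weight, mul_one]; rfl
    _ = ∑ p : (ι → Bool) × (ι → Bool), f p.1 * g p.1 * (weight α p.1 * weight α p.2) := by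
        rw [Finset.sum_mul_sum, ← Finset.univ_product_univ, Finset.sum_product]
        simp only [mul_assoc]
    _ = ∑ p : (ι → Bool) × (ι → Bool), f p.1 * g p.2 * (weight α p.1 * weight α p.2) := by
        rw [← Equiv.sum_comp hmix.toPerm]
        refine Finset.sum_congr rfl fun p _ => ?_
        simp only [Function.Involutive.coe_toPerm, h1, h2, hw]
    _ = expect α f * expect α g := by
        unfold expect
        rw [Finset.sum_mul_sum, ← Finset.univ_product_univ, Finset.sum_product]
        refine Finset.sum_congr rfl fun a _ => Finset.sum_congr rfl fun b _ => ?_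
        ring

omit [Fintype ι] in
theorem dependsOn_prod {κ : Type*} {s : Finset κ} {f : κ → (ι → Bool) → ℝ} {A : κ → Set ι}
    (hf : ∀ j ∈ s, DependsOn (f j) (A j)) :
    DependsOn (fun ω => ∏ j ∈ s, f j ω) (⋃ j ∈ s, A j) := fun _ _ h =>
  Finset.prod_congr rfl fun j hj => hf j hj fun i hi => h i (Set.mem_biUnion hj hi)

theorem expect_prod (α : ι → ℝ) {κ : Type*} {s : Finset κ} {f : κ → (ι → Bool) → ℝ}
    {A : κ → Set ι} (hf : ∀ j ∈ s, DependsOn (f j) (A j))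
    (hA : ∀ j ∈ s, ∀ j' ∈ s, j ≠ j' → Disjoint (A j) (A j')) :
    expect α (fun ω => ∏ j ∈ s, f j ω) = ∏ j ∈ s, expect α (f j) := by
  induction s using Finset.induction_on with
  | empty => simp [expect_const]
  | insert a s ha ih =>
    simp only [Finset.prod_insert ha]
    rw [expect_mul α (hf a (Finset.mem_insert_self a s))
      (dependsOn_prod fun j hj => hf j (Finset.mem_insert_of_mem hj)), ih]
    · exact fun j hj => hf j (Finset.mem_insert_of_mem hj)
    · exact fun j hj j' hj' => hA j (Finset.mem_insert_of_mem hj) j' (Finset.mem_insert_of_mem hj')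
    · simp only [Set.disjoint_iUnion_right]
      exact fun j hj => hA a (Finset.mem_insert_self a s) j (Finset.mem_insert_of_mem hj)
        fun e => ha (e ▸ hj)

/-- The indicator of a condition. -/
def ind (p : Prop) : ℝ := if p then 1 else 0

theorem ind_true {p : Prop} (h : p) : ind p = 1 := if_pos h

theorem ind_false {p : Prop} (h : ¬ p) : ind p = 0 := if_neg h

theorem ind_and (p q : Prop) : ind (p ∧ q) = ind p * ind q := by
  by_cases hp : p <;> by_cases hq : q <;> simp [ind, hp, hq]

theorem one_sub_ind (p : Prop) : 1 - ind p = ind (¬ p) := by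
  by_cases hp : p <;> simp [ind, hp]

theorem prod_ind {κ : Type*} (s : Finset κ) (p : κ → Prop) :
    ∏ j ∈ s, ind (p j) = ind (∀ j ∈ s, p j) := by
  by_cases h : ∀ j ∈ s, p j
  · rw [ind_true h]
    exact Finset.prod_eq_one fun j hj => ind_true (h j hj)
  · rw [ind_false h]
    push Not at h
    obtain ⟨j, hj, hp⟩ := h
    exact Finset.prod_eq_zero hj (ind_false hp)

omit [Fintype ι] in
theorem dependsOn_ind {p : (ι → Bool) → Prop} {A : Set ι}
    (h : ∀ ω ω', (∀ i ∈ A, ω i = ω' i) → p ω → p ω') : DependsOn (fun ω => ind (p ω)) A := by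
  intro ω ω' hω
  have : p ω ↔ p ω' := ⟨h ω ω' hω, h ω' ω fun i hi => (hω i hi).symm⟩
  simp only [this]

omit [Fintype ι] in
theorem dependsOn_coord (i : ι) {A : Set ι} (h : i ∈ A) :
    DependsOn (fun ω : ι → Bool => ind (ω i = true)) A :=
  dependsOn_ind fun _ _ hω hi => hω i h ▸ hi

/-- Multiplying by the indicator replaces the `i`-th factor at `false` by zero, so the sum still
factors over the coordinates. -/
theorem expect_coord (α : ι → ℝ) (i : ι) : expect α (fun ω => ind (ω i = true)) = α i := by
  have h : ∀ ω : ι → Bool, ind (ω i = true) * weight α ω =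
      ∏ j, if ω j = true then α j else if j = i then 0 else 1 - α j := by
    intro ω
    cases hi : ω i
    · rw [Finset.prod_eq_zero (Finset.mem_univ i) (by simp [hi])]
      simp [ind]
    · rw [ind_true rfl, one_mul, weight]
      refine Finset.prod_congr rfl fun j _ => ?_
      by_cases hj : j = i
      · subst hj; simp [hi]
      · simp [hj]
  have := Finset.prod_univ_sum (fun _ : ι => (Finset.univ : Finset Bool))
    (fun j b => if b = true then α j else if j = i then 0 else 1 - α j)
  rw [Fintype.piFinset_univ] at this
  unfold expect
  rw [Finset.sum_congr rfl fun ω _ => h ω, ← this, Finset.prod_eq_single i]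
  · simp
  · intro j _ hj
    simp [hj]
  · simp

end Expectation

variable {V : Type*} {T : TreeNetwork V} [Fintype V]

/-! ### Success probabilities in the two trees -/

variable (T) in
/-- The links between two nodes that are `k` or lie behind `k`. -/
def behind (k : V) : Set T.E := {e | ∃ p i, T.Desc k p ∧ T.Out p i ∧ e = T.lk i}

variable (T) in
/-- The link of `j` and the links behind `j`. -/
def onward (j : V) : Set T.E := {e | ∃ i, T.Desc j i ∧ e = T.lk i}

variable (T) in
/-- The probability that a working path leads from `k` outwards to some leaf. -/
def beta (α : T.E → ℝ) (k : V) : ℝ := expect α fun ω => ind (T.OpenLeaf ω k)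

variable (T) in
/-- The probability that a working path through the link of `j` leads outwards to some leaf. -/
def pass (α : T.E → ℝ) (j : V) : ℝ := α (T.lk j) * T.beta α j

variable (T) in
/-- The nodes on the outer side of `k`. -/
def nbr (k : V) : Finset V := Finset.univ.filter (T.Out k)

variable (T) in
/-- The nodes other than `C` and `D`. -/
def inner : Finset V := Finset.univ.filter fun k => ∃ p, T.Out p k

variable (T) in
/-- The node on the inner side of `k`. -/
def par (k : V) : V := if h : ∃ p, T.Out p k then h.choose else k

theorem mem_nbr {k j : V} : j ∈ T.nbr k ↔ T.Out k j := by simp [nbr]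

theorem mem_inner {k : V} : k ∈ T.inner ↔ ∃ p, T.Out p k := by simp [inner]

theorem Out.par_eq {p k : V} (h : T.Out p k) : T.par k = p := by
  have hex : ∃ p, T.Out p k := ⟨p, h⟩
  rw [par, dif_pos hex]
  exact hex.choose_spec.unique h

theorem out_par {k : V} (h : k ∈ T.inner) : T.Out (T.par k) k := by
  obtain ⟨p, hp⟩ := mem_inner.1 h
  rwa [hp.par_eq]

omit [Fintype V] in
theorem OpenLeaf.congr {ω ω' : T.E → Bool} {k : V} (hω : ∀ e ∈ T.behind k, ω e = ω' e)
    (h : T.OpenLeaf ω k) : T.OpenLeaf ω' k := by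
  obtain ⟨l, hl, hkl⟩ := h
  exact ⟨l, hl, hkl.congr fun p i hp hpi _ => hω _ ⟨p, i, hp, hpi, rfl⟩⟩

omit [Fintype V] in
theorem Out.lk_notMem_behind {k j : V} (h : T.Out k j) : T.lk j ∉ T.behind j := by
  rintro ⟨p, i, hp, hpi, e⟩
  obtain rfl := h.lk_inj e
  exact not_transGen_out j (TransGen.tail' hp hpi)

omit [Fintype V] in
theorem dependsOn_openLeaf (k : V) :
    DependsOn (fun ω : T.E → Bool => ind (T.OpenLeaf ω k)) (T.behind k) :=
  dependsOn_ind fun _ _ hω h => h.congr hω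

theorem expect_pass (α : T.E → ℝ) {k j : V} (h : T.Out k j) :
    expect α (fun ω => ind (ω (T.lk j) = true ∧ T.OpenLeaf ω j)) = T.pass α j := by
  simp only [ind_and]
  rw [expect_mul α (dependsOn_coord (T.lk j) (Set.mem_singleton _)) (dependsOn_openLeaf j),
    expect_coord]
  · rfl
  · exact Set.disjoint_singleton_left.2 h.lk_notMem_behind

omit [Fintype V] in
theorem behind_subset_onward (j : V) : T.behind j ⊆ T.onward j := by
  rintro e ⟨p, i, hp, hpi, rfl⟩
  exact ⟨i, ReflTransGen.tail hp hpi, rfl⟩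

omit [Fintype V] in
theorem dependsOn_pass (j : V) :
    DependsOn (fun ω : T.E → Bool => ind (ω (T.lk j) = true ∧ T.OpenLeaf ω j)) (T.onward j) :=
  dependsOn_ind fun _ _ hω h =>
    ⟨hω _ ⟨j, .refl, rfl⟩ ▸ h.1, h.2.congr fun e he => hω e (behind_subset_onward j he)⟩

omit [Fintype V] in
theorem Out.of_desc {p j i : V} (h : T.Out p j) (hi : T.Desc j i) : ∃ p', T.Out p' i := by
  rcases ReflTransGen.cases_tail hi with e | ⟨b, -, hb⟩
  · exact ⟨p, e ▸ h⟩
  · exact ⟨b, hb⟩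

omit [Fintype V] in
theorem disjoint_onward {p j j' : V} (h : T.Out p j) (h1 : ¬ T.Desc j j')
    (h2 : ¬ T.Desc j' j) : Disjoint (T.onward j) (T.onward j') := by
  rw [Set.disjoint_left]
  rintro e ⟨i, hi, rfl⟩ ⟨i', hi', e⟩
  obtain ⟨q, hq⟩ := h.of_desc hi
  obtain rfl := hq.lk_inj e
  exact (hi.total hi').elim h1 h2

theorem beta_leaf (α : T.E → ℝ) {k : V} (h : T.Leaf k) : T.beta α k = 1 := by
  have : ∀ ω : T.E → Bool, ind (T.OpenLeaf ω k) = 1 := fun ω => ind_true h.openLeaf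
  simp [beta, this, expect_const]

/-- No leaf is reached exactly when the passage through each outer neighbour fails; these events
depend on disjoint sets of links. -/
theorem beta_eq (α : T.E → ℝ) {k : V} (h : ¬ T.Leaf k) :
    T.beta α k = 1 - ∏ j ∈ T.nbr k, (1 - T.pass α j) := by
  have h1 : ∀ ω : T.E → Bool, ind (T.OpenLeaf ω k) =
      1 - ∏ j ∈ T.nbr k, (1 - ind (ω (T.lk j) = true ∧ T.OpenLeaf ω j)) := by
    intro ω
    simp only [one_sub_ind, prod_ind, openLeaf_iff h, mem_nbr]
    congr 1
    simp
  unfold beta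
  simp only [h1, expect_one_sub]
  rw [expect_prod α (A := T.onward)]
  · congr 1
    refine Finset.prod_congr rfl fun j hj => ?_
    rw [expect_one_sub, expect_pass α (mem_nbr.1 hj)]
  · intro j _ ω ω' hω
    exact congrArg (1 - ·) (dependsOn_pass j hω)
  · intro j hj j' hj' hne
    rw [mem_nbr] at hj hj'
    refine disjoint_onward hj (fun hd => hne ?_) (fun hd => hne ?_)
    · exact eq_of_out_of_desc hj hj' hd .refl
    · exact eq_of_out_of_desc hj hj' .refl hd

theorem pass_pos_le {α : T.E → ℝ} (hα : α ∈ T.Param) {j : V} (h : 0 < T.beta α j ∧ T.beta α j ≤ 1) :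
    0 < T.pass α j ∧ T.pass α j ≤ 1 :=
  ⟨mul_pos (hα _).1 h.1, mul_le_one₀ (hα _).2 h.1.le h.2⟩

theorem exists_mem_nbr {k : V} (h : ¬ T.Leaf k) : ∃ j, j ∈ T.nbr k := by
  simpa [Leaf, mem_nbr] using h

theorem beta_pos_le {α : T.E → ℝ} (hα : α ∈ T.Param) (k : V) :
    0 < T.beta α k ∧ T.beta α k ≤ 1 := by
  induction k using (wf_out_swap (T := T)).induction with
  | _ k ih =>
    by_cases hk : T.Leaf k
    · simp [beta_leaf α hk]
    · rw [beta_eq α hk]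
      have hq : ∀ j ∈ T.nbr k, 0 < T.pass α j ∧ T.pass α j ≤ 1 := fun j hj =>
        pass_pos_le hα (ih j (mem_nbr.1 hj))
      have h0 : 0 ≤ ∏ j ∈ T.nbr k, (1 - T.pass α j) :=
        Finset.prod_nonneg fun j hj => by linarith [(hq j hj).2]
      obtain ⟨j, hj⟩ := exists_mem_nbr hk
      have h1 : ∏ j ∈ T.nbr k, (1 - T.pass α j) ≤ 1 - T.pass α j := by
        rw [← Finset.mul_prod_erase _ _ hj]
        refine mul_le_of_le_one_right (by linarith [(hq j hj).2]) (Finset.prod_le_one ?_ ?_)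
        · exact fun i hi => by linarith [(hq i (Finset.mem_of_mem_erase hi)).2]
        · exact fun i hi => by linarith [(hq i (Finset.mem_of_mem_erase hi)).1]
      constructor <;> linarith [(hq j hj).1]

/-! ### Probabilities of outcomes -/

theorem sum_prob (α : T.E → ℝ) (S : Finset T.Outcome) :
    ∑ x ∈ S, T.prob α x = expect α fun ω => ind (T.outcome ω ∈ S) := by
  unfold prob expect
  rw [Finset.sum_comm]
  refine Finset.sum_congr (by ext; simp) fun ω _ => ?_
  rw [Finset.sum_ite_eq]
  by_cases h : T.outcome ω ∈ S <;> simp [h, ind, weight]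

theorem sum_prob_omega (α : T.E → ℝ) : ∑ x ∈ T.Omega, T.prob α x = 1 := by
  rw [sum_prob]
  simp only [outcome_mem_omega, ind_true, expect_const]

variable (T) in
/-- The probability that some probe crosses `k`. -/
def gam (α : T.E → ℝ) (k : V) : ℝ := ∑ x ∈ T.OmegaAt k, T.prob α x

theorem outcome_false : T.outcome (fun _ => false) = 0 := by
  ext a s
  rw [outcome_apply]
  simp

theorem zero_mem_omega : (0 : T.Outcome) ∈ T.Omega := mem_omega.2 ⟨_, outcome_false⟩

theorem omega_eq : T.Omega = insert 0 (T.OmegaAt T.C) := by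
  ext x
  rw [Finset.mem_insert]
  constructor
  · intro hx
    by_cases h : x = 0
    · exact .inl h
    · exact .inr ((mem_omegaAt_C hx).2 h)
  · rintro (rfl | h)
    · exact zero_mem_omega
    · exact omegaAt_subset _ h

theorem zero_notMem_omegaAt_C : (0 : T.Outcome) ∉ T.OmegaAt T.C := fun h =>
  (mem_omegaAt_C zero_mem_omega).1 h rfl

theorem sum_omega (f : T.Outcome → ℝ) :
    ∑ x ∈ T.Omega, f x = f 0 + ∑ x ∈ T.OmegaAt T.C, f x := by
  rw [omega_eq, Finset.sum_insert zero_notMem_omegaAt_C]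

theorem prob_zero (α : T.E → ℝ) : T.prob α 0 = 1 - T.gam α T.C := by
  have h := sum_prob_omega α
  rw [sum_omega] at h
  unfold gam
  linarith

variable (T) in
/-- The probability that all links between `CD` and `k` work, `CD` works, and the root of the other
tree is connected with a leaf. -/
def reach (α : T.E → ℝ) (k : V) : ℝ :=
  expect α fun ω => ind (ω T.CD = true ∧ T.Open ω (T.root k) k ∧ T.OpenLeaf ω (T.opp k))

variable (T) in
/-- The links that are not behind `k` and are relevant for reaching `k`. -/
def away (k : V) : Set T.E :=
  {e | e = T.CD ∨ (∃ p i, T.Out p i ∧ T.Desc i k ∧ e = T.lk i) ∨ e ∈ T.behind (T.opp k)}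

omit [Fintype V] in
theorem dependsOn_reach (k : V) :
    DependsOn (fun ω : T.E → Bool =>
      ind (ω T.CD = true ∧ T.Open ω (T.root k) k ∧ T.OpenLeaf ω (T.opp k))) (T.away k) :=
  dependsOn_ind fun _ _ hω h =>
    ⟨hω _ (.inl rfl) ▸ h.1, h.2.1.congr fun p i _ hpi hi => hω _ (.inr (.inl ⟨p, i, hpi, hi, rfl⟩)),
      h.2.2.congr fun _ he => hω _ (.inr (.inr he))⟩

omit [Fintype V] in
theorem disjoint_away_behind (k : V) : Disjoint (T.away k) (T.behind k) := by
  rw [Set.disjoint_right]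
  rintro e ⟨p, i, hp, hpi, rfl⟩ (h | ⟨q, i', -, hi', h⟩ | ⟨q, i', hq, hqi', h⟩)
  · exact hpi.lk_ne_CD h
  · obtain rfl := hpi.lk_inj h
    exact not_transGen_out i (TransGen.tail' (ReflTransGen.trans hi' hp) hpi)
  · obtain rfl := hpi.lk_inj h
    exact not_desc_opp (ReflTransGen.tail hq hqi')
      (ReflTransGen.tail (ReflTransGen.trans (desc_root k) hp) hpi)

omit [Fintype V] in
theorem root_opp (k : V) : T.root (T.opp k) = T.opp k := by
  unfold opp
  split_ifs <;> simp

omit [Fintype V] in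
theorem hit_opp {ω : T.E → Bool} {k : V} : T.Hit ω (T.opp k) ↔ T.OpenLeaf ω (T.opp k) := by
  rw [Hit, root_opp]
  exact ⟨fun h => h.2, fun h => ⟨.refl, h⟩⟩

/-- Reaching `k` uses links in `away k`, continuing to a leaf uses links in `behind k`, and these
sets are disjoint. -/
theorem gam_eq (α : T.E → ℝ) (k : V) : T.gam α k = T.reach α k * T.beta α k := by
  unfold gam reach beta
  rw [sum_prob, ← expect_mul α (dependsOn_reach k) (dependsOn_openLeaf k) (disjoint_away_behind k)]
  congr 1
  ext ω
  rw [outcome_mem_omegaAt, hit_opp, Hit, ← ind_and]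
  congr 1
  apply propext
  tauto

theorem reach_out (α : T.E → ℝ) {k j : V} (h : T.Out k j) :
    T.reach α j = α (T.lk j) * T.reach α k := by
  unfold reach
  rw [← expect_coord α (T.lk j),
    ← expect_mul α (dependsOn_coord (T.lk j) (Set.mem_singleton _)) (dependsOn_reach k)]
  · congr 1
    ext ω
    rw [← ind_and]
    congr 1
    apply propext
    rw [h.root_eq, h.opp_eq, open_iff_of_out h fun e => not_out_root (e ▸ h)]
    tauto
  · rw [Set.disjoint_singleton_left]
    exact Set.disjoint_right.1 (disjoint_away_behind k) ⟨k, j, .refl, h, rfl⟩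

theorem reach_C (α : T.E → ℝ) : T.reach α T.C = α T.CD * T.beta α T.D := by
  unfold reach beta
  rw [← expect_coord α T.CD, ← expect_mul α (dependsOn_coord T.CD (Set.mem_singleton _))
    (dependsOn_openLeaf T.D)]
  · congr 1
    ext ω
    rw [← ind_and, root_C, opp_C]
    congr 1
    apply propext
    have : T.Open ω T.C T.C := .refl
    tauto
  · rw [Set.disjoint_singleton_left]
    rintro ⟨p, i, -, hpi, e⟩
    exact hpi.lk_ne_CD e.symm

theorem reach_D (α : T.E → ℝ) : T.reach α T.D = α T.CD * T.beta α T.C := by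
  unfold reach beta
  rw [← expect_coord α T.CD, ← expect_mul α (dependsOn_coord T.CD (Set.mem_singleton _))
    (dependsOn_openLeaf T.C)]
  · congr 1
    ext ω
    rw [← ind_and, root_D, opp_D]
    congr 1
    apply propext
    have : T.Open ω T.D T.D := .refl
    tauto
  · rw [Set.disjoint_singleton_left]
    rintro ⟨p, i, -, hpi, e⟩
    exact hpi.lk_ne_CD e.symm

/-- The event splits into conditions local to the nodes. A crossed node has a working link; at the
boundary, where `par j` is crossed and `j` is not, the passage through `j` must fail; beyond the
boundary nothing is required. -/
theorem outcome_eq_iff {ω : T.E → Bool} {x : T.Outcome} (hx : x ∈ T.OmegaAt T.C) :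
    T.outcome ω = x ↔ ω T.CD = true ∧ ∀ j ∈ T.inner,
      (x ∈ T.OmegaAt j → ω (T.lk j) = true) ∧
      (x ∉ T.OmegaAt j → x ∈ T.OmegaAt (T.par j) → ¬ (ω (T.lk j) = true ∧ T.OpenLeaf ω j)) := by
  constructor
  · rintro rfl
    refine ⟨((outcome_mem_omegaAt ω _).1 hx).1, fun j hj => ⟨fun h => ?_, fun h hp hω => h ?_⟩⟩
    · obtain ⟨p, hp⟩ := mem_inner.1 hj
      have ho := ((outcome_mem_omegaAt ω _).1 h).2.1.1
      rw [open_iff_of_out hp fun e => not_out_root (e ▸ hp)] at ho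
      exact ho.2
    · have ho := out_par hj
      rw [outcome_mem_omegaAt] at hp ⊢
      rw [ho.opp_eq]
      refine ⟨hp.1, ⟨?_, hω.2⟩, hp.2.2⟩
      rw [open_iff_of_out ho fun e => not_out_root (e ▸ ho), ho.root_eq]
      exact ⟨hp.2.1.1, hω.1⟩
  · rintro ⟨hCD, hω⟩
    obtain ⟨ω₀, rfl⟩ := mem_omega.1 (omegaAt_subset _ hx)
    have hroot : ∀ k, (∀ p, ¬ T.Out p k) → T.outcome ω₀ ∈ T.OmegaAt k := by
      intro k hk
      have : ¬ (k ≠ T.C ∧ k ≠ T.D) := fun h => by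
        obtain ⟨p, hp⟩ := exists_out_iff.2 h
        exact hk p hp
      by_cases hC : k = T.C
      · rwa [hC]
      · rw [show k = T.D by tauto, ← omegaAt_C_eq]
        exact hx
    -- Outward induction: the links of crossed nodes work all the way from the root.
    have h1 : ∀ k, T.outcome ω₀ ∈ T.OmegaAt k → T.Open ω (T.root k) k := by
      intro k
      induction k using (wf_out (T := T)).induction with
      | _ k ih =>
        intro hk
        by_cases hp : ∃ p, T.Out p k
        · obtain ⟨p, hp⟩ := hp
          rw [open_iff_of_out hp fun e => not_out_root (e ▸ hp), hp.root_eq]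
          exact ⟨ih p hp (omegaAt_mono (ReflTransGen.single hp) hk),
            (hω k (mem_inner.2 ⟨p, hp⟩)).1 hk⟩
        · have : k = T.root k := by
            rcases ReflTransGen.cases_tail (desc_root k) with e | ⟨b, -, hb⟩
            · exact e
            · exact absurd ⟨b, hb⟩ hp
          rw [← this]
          exact .refl
    -- An uncrossed node joined to both a leaf and its root would carry this property inwards up to
    -- the boundary, where the passage is forbidden.
    have h2 : ∀ k, T.outcome ω₀ ∉ T.OmegaAt k → T.OpenLeaf ω k → ¬ T.Open ω (T.root k) k := by
      intro k
      induction k using (wf_out (T := T)).induction with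
      | _ k ih =>
        intro hk hl ho
        by_cases hp : ∃ p, T.Out p k
        · have hi := mem_inner.2 hp
          obtain ⟨p, hp⟩ := hp
          rw [open_iff_of_out hp fun e => not_out_root (e ▸ hp), hp.root_eq] at ho
          by_cases hpx : T.outcome ω₀ ∈ T.OmegaAt p
          · exact (hω k hi).2 hk (hp.par_eq.symm ▸ hpx) ⟨ho.2, hl⟩
          · refine ih p hp hpx ?_ ho.1
            obtain ⟨l, hl, hkl⟩ := hl
            exact ⟨l, hl, ReflTransGen.head ⟨hp, ho.2⟩ hkl⟩
        · exact hk (hroot k fun p h => hp ⟨p, h⟩)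
    have hx' := (outcome_mem_omegaAt ω₀ _).1 hx
    rw [opp_C] at hx'
    have h3 : ∀ l, T.Leaf l → (T.Open ω (T.root l) l ↔ T.Open ω₀ (T.root l) l) := by
      intro l hl
      have h4 : T.outcome ω₀ ∈ T.OmegaAt l ↔ T.Open ω₀ (T.root l) l := by
        rw [outcome_mem_omegaAt]
        refine ⟨fun h => h.2.1.1, fun h => ⟨hx'.1, ⟨h, hl.openLeaf⟩, ?_⟩⟩
        unfold opp
        split_ifs
        · exact hx'.2.2
        · exact hx'.2.1
      rw [← h4]
      exact ⟨fun h => by_contra fun hn => h2 l hn hl.openLeaf h, h1 l⟩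
    ext a s
    have ha := IsReceiver.lower a.2
    have hs := IsSource.upper s.2
    have h5 := h3 a (ha.leaf_iff.2 a.2)
    have h6 := h3 s (hs.leaf_iff.2 s.2)
    simp only [root, ha.not_upper, hs, if_true, if_false] at h5 h6
    simp only [outcome_apply, h5, h6, hCD, hx'.1]

/-- The local conditions of `outcome_eq_iff` involve disjoint sets of links, so their probabilities
multiply. -/
theorem prob_eq (α : T.E → ℝ) {x : T.Outcome} (hx : x ∈ T.OmegaAt T.C) :
    T.prob α x = α T.CD * ∏ j ∈ T.inner,
      if x ∈ T.OmegaAt j then α (T.lk j)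
      else if x ∈ T.OmegaAt (T.par j) then 1 - T.pass α j else 1 := by
  have h0 : T.prob α x = expect α fun ω => ind (T.outcome ω = x) := by
    have := sum_prob α {x}
    simpa using this
  let f : V → (T.E → Bool) → ℝ := fun j ω =>
    if x ∈ T.OmegaAt j then ind (ω (T.lk j) = true)
    else if x ∈ T.OmegaAt (T.par j) then 1 - ind (ω (T.lk j) = true ∧ T.OpenLeaf ω j) else 1
  let A : V → Set T.E := fun j =>
    if x ∈ T.OmegaAt j then {T.lk j} else if x ∈ T.OmegaAt (T.par j) then T.onward j else ∅
  have hf : ∀ j ∈ T.inner, DependsOn (f j) (A j) := by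
    intro j _
    simp only [f, A]
    split_ifs
    · exact dependsOn_coord _ (Set.mem_singleton _)
    · exact fun ω ω' hω => congrArg (1 - ·) (dependsOn_pass j hω)
    · exact fun _ _ _ => rfl
  have hsub : ∀ j, A j ⊆ T.onward j := by
    intro j
    simp only [A]
    split_ifs
    · exact Set.singleton_subset_iff.2 ⟨j, .refl, rfl⟩
    · exact subset_rfl
    · exact Set.empty_subset _
  -- Crossed nodes contribute single links. A boundary node cannot lie behind another one, since its
  -- inner neighbour is crossed and nothing behind an uncrossed node is.
  have hA : ∀ j ∈ T.inner, ∀ j' ∈ T.inner, j ≠ j' → Disjoint (A j) (A j') := by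
    have aux : ∀ j ∈ T.inner, ∀ j', x ∈ T.OmegaAt j → x ∉ T.OmegaAt j' →
        Disjoint {T.lk j} (T.onward j') := by
      intro j hj j' hx hx'
      rw [Set.disjoint_singleton_left]
      rintro ⟨i, hi, e⟩
      obtain rfl := (out_par hj).lk_inj e
      exact hx' (omegaAt_mono hi hx)
    have aux2 : ∀ j, ∀ j' ∈ T.inner, j ≠ j' → x ∉ T.OmegaAt j → x ∈ T.OmegaAt (T.par j') →
        ¬ T.Desc j j' := fun j j' hj' hne h h' hd =>
      h (omegaAt_mono (hd.of_out (Ne.symm hne) (out_par hj')) h')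
    intro j hj j' hj' hne
    simp only [A]
    split_ifs with h1 h2 h3 h4 h5 h6
    · rw [Set.disjoint_singleton]
      exact fun e => hne ((out_par hj).lk_inj e)
    · exact aux j hj j' h1 h2
    · exact Set.disjoint_empty _
    · exact (aux j' hj' j h5 h1).symm
    · exact disjoint_onward (out_par hj) (aux2 j j' hj' hne h1 h6)
        (aux2 j' j hj (Ne.symm hne) h5 h4)
    · exact Set.disjoint_empty _
    all_goals exact Set.empty_disjoint _
  have h1 : ∀ ω, ind (T.outcome ω = x) = ind (ω T.CD = true) * ∏ j ∈ T.inner, f j ω := by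
    intro ω
    have : ∀ j, f j ω = ind ((x ∈ T.OmegaAt j → ω (T.lk j) = true) ∧
        (x ∉ T.OmegaAt j → x ∈ T.OmegaAt (T.par j) →
          ¬ (ω (T.lk j) = true ∧ T.OpenLeaf ω j))) := by
      intro j
      simp only [f, one_sub_ind]
      split_ifs with h1 h2
      · simp [h1]
      · simp only [h1, h2, false_imp_iff, true_and, not_false_iff, true_imp_iff]
      · simp [h1, h2, ind]
    simp only [this, prod_ind, ← ind_and, outcome_eq_iff hx]
  rw [h0]
  simp only [h1]
  rw [expect_mul α (dependsOn_coord T.CD (Set.mem_singleton _)) (dependsOn_prod hf),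
    expect_coord, expect_prod α hf hA]
  · congr 1
    refine Finset.prod_congr rfl fun j hj => ?_
    simp only [f]
    split_ifs
    · exact expect_coord _ _
    · rw [expect_one_sub, expect_pass α (out_par hj)]
    · exact expect_const _ _
  · rw [Set.disjoint_singleton_left, Set.mem_iUnion₂]
    rintro ⟨j, hj, he⟩
    obtain ⟨i, hi, e⟩ := hsub j he
    obtain ⟨q, hq⟩ := (out_par hj).of_desc hi
    exact hq.lk_ne_CD e.symm

end

noncomputable section

open scoped Classical
open Filter Topology

/-! ### The equation for the success probabilities -/

section Root

variable {ι : Type*}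

/-- The equation that determines the success probability `A` up to a node from the probability `g`
that a probe crosses the node and the probabilities `c j` for its outer neighbours. -/
def IsRoot (g : ℝ) (s : Finset ι) (c : ι → ℝ) (A : ℝ) : Prop :=
  g ≤ A ∧ 1 - g / A = ∏ j ∈ s, (1 - c j / A)

/-- The inequalities under which `IsRoot` has exactly one solution. -/
structure Admissible (g : ℝ) (s : Finset ι) (c : ι → ℝ) : Prop where
  pos : 0 < g
  pos_of_mem : ∀ j ∈ s, 0 < c j
  lt_of_mem : ∀ j ∈ s, c j < g
  lt_sum : g < ∑ j ∈ s, c j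

/-- The increasing function of `A` that takes the value `g` at the solution of `IsRoot`. -/
def rootFun (s : Finset ι) (c : ι → ℝ) (A : ℝ) : ℝ := A * (1 - ∏ j ∈ s, (1 - c j / A))

variable {g : ℝ} {s : Finset ι} {c : ι → ℝ} {A B : ℝ}

theorem isRoot_iff (hg : 0 < g) : IsRoot g s c A ↔ g ≤ A ∧ rootFun s c A = g := by
  refine and_congr_right fun h => ?_
  have hA : A ≠ 0 := (hg.trans_le h).ne'
  unfold rootFun
  constructor
  · intro e
    rw [← e]
    field_simp
    ring
  · intro e
    nth_rw 1 [← e]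
    field_simp
    ring

/-- Iterated, this writes `rootFun` as a sum of terms `c a` times a partial product. Each such term
is nondecreasing in `A` once `A` exceeds the positive `c j`, so monotonicity needs no derivative. -/
theorem rootFun_insert {a : ι} (ha : a ∉ s) (hA : A ≠ 0) :
    rootFun (insert a s) c A = rootFun s c A + c a * ∏ j ∈ s, (1 - c j / A) := by
  unfold rootFun
  rw [Finset.prod_insert ha]
  field_simp
  ring

theorem one_sub_div_pos {x : ℝ} (hxA : x < A) (hA : 0 < A) : 0 < 1 - x / A := by
  rw [sub_pos, div_lt_one hA]
  exact hxA

theorem prod_one_sub_div_lt (hA : 0 < A) (hAB : A < B) (hc : ∀ j ∈ s, 0 < c j)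
    (hcA : ∀ j ∈ s, c j < A) (hs : s.Nonempty) :
    ∏ j ∈ s, (1 - c j / A) < ∏ j ∈ s, (1 - c j / B) := by
  refine Finset.prod_lt_prod_of_nonempty (fun j hj => one_sub_div_pos (hcA j hj) hA) ?_ hs
  intro j hj
  exact sub_lt_sub_left (div_lt_div_of_pos_left (hc j hj) hA hAB) 1

theorem rootFun_mono (hA : 0 < A) (hAB : A < B) (hc : ∀ j ∈ s, 0 < c j)
    (hcA : ∀ j ∈ s, c j < A) : rootFun s c A ≤ rootFun s c B := by
  induction s using Finset.induction_on with
  | empty => simp [rootFun]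
  | insert a s ha ih =>
    simp only [Finset.forall_mem_insert] at hc hcA
    rw [rootFun_insert ha hA.ne', rootFun_insert ha (hA.trans hAB).ne']
    refine add_le_add (ih hc.2 hcA.2) (mul_le_mul_of_nonneg_left ?_ hc.1.le)
    rcases s.eq_empty_or_nonempty with rfl | hs
    · simp
    · exact (prod_one_sub_div_lt hA hAB hc.2 hcA.2 hs).le

theorem Admissible.rootFun_lt (h : Admissible g s c) (hA : g ≤ A) (hAB : A < B) :
    rootFun s c A < rootFun s c B := by
  have hA0 := h.pos.trans_le hA
  have hc := h.pos_of_mem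
  have hcA : ∀ j ∈ s, c j < A := fun j hj => (h.lt_of_mem j hj).trans_le hA
  rcases s.eq_empty_or_nonempty with rfl | ⟨a, ha⟩
  · have := h.lt_sum
    have := h.pos
    simp at *
    linarith
  rw [← Finset.insert_erase ha] at hc hcA ⊢
  simp only [Finset.forall_mem_insert] at hc hcA
  have ha' := Finset.notMem_erase a s
  rw [rootFun_insert ha' hA0.ne', rootFun_insert ha' (hA0.trans hAB).ne']
  refine add_lt_add_of_le_of_lt (rootFun_mono hA0 hAB hc.2 hcA.2)
    (mul_lt_mul_of_pos_left (prod_one_sub_div_lt hA0 hAB hc.2 hcA.2 ?_) hc.1)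
  -- Strictness needs a second index: if `a` were the only one, `lt_sum` would contradict
  -- `lt_of_mem`.
  by_contra hne
  rw [Finset.not_nonempty_iff_eq_empty] at hne
  have h1 := h.lt_sum
  rw [← Finset.add_sum_erase s c ha, hne, Finset.sum_empty] at h1
  linarith [h.lt_of_mem a ha]

theorem Admissible.rootFun_self_lt (h : Admissible g s c) : rootFun s c g < g := by
  have : 0 < ∏ j ∈ s, (1 - c j / g) :=
    Finset.prod_pos fun j hj => one_sub_div_pos (h.lt_of_mem j hj) h.pos
  unfold rootFun
  nlinarith [h.pos]

/-- For large `B` the value approaches the sum `S` of the `c j`, which exceeds `g`. Quantitatively,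
the product is at most `exp (-S/B)`, hence at most `1/(1 + S/B)`, so `rootFun s c B` is at least `B
S/(B + S)`. -/
theorem Admissible.exists_lt_rootFun (h : Admissible g s c) : ∃ B, g < B ∧ g < rootFun s c B := by
  set S := ∑ j ∈ s, c j with hS
  have hSg : 0 < S - g := sub_pos.2 h.lt_sum
  have hS0 : 0 < S := h.pos.trans h.lt_sum
  have hg := h.pos
  have hq : 0 < g * S / (S - g) := by positivity
  -- The bound `B S/(B + S)` exceeds `g` exactly when `B (S - g) > g S`; adding `g` to the critical
  -- value makes this strict and gives `g < B`.
  refine ⟨g * S / (S - g) + g, by linarith, ?_⟩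
  set B := g * S / (S - g) + g with hB
  have hB0 : 0 < B := by linarith
  have h1 : ∏ j ∈ s, (1 - c j / B) ≤ Real.exp (-(S / B)) := by
    rw [hS, Finset.sum_div, ← Finset.sum_neg_distrib, Real.exp_sum]
    refine Finset.prod_le_prod (fun j hj => ?_) fun j _ => ?_
    · exact (one_sub_div_pos ((h.lt_of_mem j hj).trans (by linarith)) hB0).le
    · linarith [Real.add_one_le_exp (-(c j / B))]
  have h2 : Real.exp (-(S / B)) ≤ 1 / (1 + S / B) := by
    rw [Real.exp_neg, one_div]
    exact inv_anti₀ (by positivity) (by linarith [Real.add_one_le_exp (S / B)])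
  have h3 : g < B * (1 - 1 / (1 + S / B)) := by
    have e : B * (1 - 1 / (1 + S / B)) = B * S / (B + S) := by
      field_simp
      ring
    rw [e, lt_div_iff₀ (by positivity)]
    have : B * (S - g) = g * S + g * (S - g) := by
      rw [hB, add_mul, div_mul_cancel₀ _ hSg.ne']
    nlinarith
  refine h3.trans_le ?_
  unfold rootFun
  exact mul_le_mul_of_nonneg_left (by linarith) hB0.le

theorem continuousOn_rootFun : ContinuousOn (rootFun s c) (Set.Ioi 0) := by
  unfold rootFun
  refine continuousOn_id.mul (continuousOn_const.sub (continuousOn_finsetProd s fun j _ => ?_))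
  exact continuousOn_const.sub (continuousOn_const.div continuousOn_id fun x hx => (ne_of_gt hx))

theorem Admissible.existsUnique (h : Admissible g s c) : ∃! A, IsRoot g s c A := by
  obtain ⟨B, hB, hB'⟩ := h.exists_lt_rootFun
  have hcont : ContinuousOn (rootFun s c) (Set.Icc g B) :=
    continuousOn_rootFun.mono fun x hx => h.pos.trans_le hx.1
  obtain ⟨A, hA, hAg⟩ := intermediate_value_Icc hB.le hcont ⟨h.rootFun_self_lt.le, hB'.le⟩
  refine ⟨A, (isRoot_iff h.pos).2 ⟨hA.1, hAg⟩, fun A' hA' => ?_⟩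
  replace hA' := (isRoot_iff h.pos).1 hA'
  rcases lt_trichotomy A' A with hlt | heq | hlt
  · linarith [h.rootFun_lt hA'.1 hlt, hA'.2]
  · exact heq
  · linarith [h.rootFun_lt hA.1 hlt, hA'.2]

theorem Admissible.lt_of_isRoot (h : Admissible g s c) (hA : IsRoot g s c A) : g < A := by
  rw [isRoot_iff h.pos] at hA
  refine lt_of_le_of_ne hA.1 ?_
  rintro rfl
  exact h.rootFun_self_lt.ne hA.2

variable {β : Type*} {l : Filter β} {g' : β → ℝ} {c' : β → ι → ℝ}

theorem Admissible.eventually (h : Admissible g s c) (hg : Tendsto g' l (𝓝 g))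
    (hc : ∀ j ∈ s, Tendsto (fun b => c' b j) l (𝓝 (c j))) :
    ∀ᶠ b in l, Admissible (g' b) s (c' b) := by
  have h1 := hg.eventually (lt_mem_nhds h.pos)
  have h2 : ∀ᶠ b in l, ∀ j ∈ s, 0 < c' b j := (Finset.eventually_all s).2 fun j hj =>
    (hc j hj).eventually (lt_mem_nhds (h.pos_of_mem j hj))
  have h3 : ∀ᶠ b in l, ∀ j ∈ s, c' b j < g' b := (Finset.eventually_all s).2 fun j hj =>
    (hc j hj).eventually_lt hg (h.lt_of_mem j hj)
  have h4 := hg.eventually_lt (tendsto_finsetSum s hc) h.lt_sum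
  filter_upwards [h1, h2, h3, h4] with b h1 h2 h3 h4 using ⟨h1, h2, h3, h4⟩

/-- At a fixed `B ≠ A` with `g < B`, the strict comparison of `rootFun` with `g` survives small
perturbations, and monotonicity then puts the perturbed root on the same side of `B` as `A`. -/
theorem Admissible.tendsto_root (h : Admissible g s c) (hg : Tendsto g' l (𝓝 g))
    (hc : ∀ j ∈ s, Tendsto (fun b => c' b j) l (𝓝 (c j))) (hA : IsRoot g s c A) {A' : β → ℝ}
    (hA' : ∀ᶠ b in l, IsRoot (g' b) s (c' b) (A' b)) : Tendsto A' l (𝓝 A) := by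
  have hgA := h.lt_of_isRoot hA
  have hfun : ∀ B, Tendsto (fun b => rootFun s (c' b) B) l (𝓝 (rootFun s c B)) := fun B =>
    tendsto_const_nhds.mul (tendsto_const_nhds.sub (tendsto_finsetProd s fun j hj =>
      tendsto_const_nhds.sub ((hc j hj).div_const B)))
  have hA2 := ((isRoot_iff h.pos).1 hA).2
  have hlow : ∀ B, g < B → B < A → ∀ᶠ b in l, B < A' b := by
    intro B hgB hBA
    have h1 : rootFun s c B < g := hA2 ▸ h.rootFun_lt hgB.le hBA
    filter_upwards [(hfun B).eventually_lt hg h1, h.eventually hg hc, hA',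
      hg.eventually (gt_mem_nhds hgB)] with b hb hadm hroot hgb
    rw [isRoot_iff hadm.pos] at hroot
    by_contra hlt
    rcases (not_lt.1 hlt).lt_or_eq with hlt | heq
    · linarith [hadm.rootFun_lt hroot.1 hlt, hroot.2]
    · rw [← heq] at hb
      linarith [hroot.2]
  rw [tendsto_order]
  constructor
  · intro a ha
    -- The maximum with `g` keeps `B` in the range where `rootFun` is known to increase.
    obtain ⟨B, hB, hBA⟩ := exists_between (max_lt ha hgA)
    filter_upwards [hlow B ((le_max_right a g).trans_lt hB) hBA] with b hb
    exact ((le_max_left a g).trans_lt hB).trans hb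
  · intro B hAB
    have h1 : g < rootFun s c B := hA2 ▸ h.rootFun_lt hgA.le hAB
    filter_upwards [hg.eventually_lt (hfun B) h1, h.eventually hg hc, hA',
      hg.eventually (gt_mem_nhds (hgA.trans hAB))] with b hb hadm hroot hgb
    rw [isRoot_iff hadm.pos] at hroot
    by_contra hlt
    rcases (not_lt.1 hlt).lt_or_eq with hlt | heq
    · linarith [hadm.rootFun_lt hgb.le hlt, hroot.2]
    · rw [heq] at hb
      linarith [hroot.2]

end Root

variable {V : Type*} {T : TreeNetwork V} [Fintype V]

/-! ### Admissibility of the total weights of the sets `OmegaAt k` -/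

omit [Fintype V] in
theorem open_true {k j : V} (h : T.Desc k j) : T.Open (fun _ => true) k j := by
  induction h with
  | refl => exact .refl
  | tail _ h ih => exact ReflTransGen.tail ih ⟨h, rfl⟩

theorem outcome_true_mem (k : V) : T.outcome (fun _ => true) ∈ T.OmegaAt k := by
  have h : ∀ k : V, T.Hit (fun _ => true) k := by
    intro k
    obtain ⟨l, hl, hkl⟩ := exists_leaf k
    exact ⟨open_true (desc_root k), l, hl, open_true hkl⟩
  exact (outcome_mem_omegaAt _ k).2 ⟨rfl, h k, h _⟩

theorem exists_out_ne {k j : V} (h : T.Out k j) : ∃ j', T.Out k j' ∧ j' ≠ j := by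
  have h1 : 1 < {j | T.Out k j}.ncard := two_le_ncard_out fun hl => hl j h
  obtain ⟨j', h2, h3⟩ := Set.exists_ne_of_one_lt_ncard h1 j
  exact ⟨j', h2, h3⟩

theorem exists_mem_omegaAt_notMem {k j : V} (h : T.Out k j) :
    ∃ x ∈ T.OmegaAt k, x ∉ T.OmegaAt j := by
  obtain ⟨j', hj', hne⟩ := exists_out_ne h
  -- Only the link of `j` fails; `k` is still crossed by way of its second neighbour `j'`.
  let ω : T.E → Bool := fun e => decide (e ≠ T.lk j)
  have hlk : ∀ i, i ≠ j → ω (T.lk i) = true := by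
    intro i hi
    simp only [ω, ne_eq, decide_not, Bool.not_eq_true', decide_eq_false_iff_not]
    exact fun e => hi (h.lk_inj e.symm).symm
  have hopen : ∀ i l, T.Desc i l → ¬ T.Desc j l → T.Open ω i l := by
    intro i l hil hjl
    refine (open_true hil).congr fun p m _ _ hml => (hlk m ?_).symm
    rintro rfl
    exact hjl hml
  refine ⟨T.outcome ω, (outcome_mem_omegaAt ω k).2 ⟨?_, ?_, ?_⟩, fun hj => ?_⟩
  · simp only [ω, ne_eq, decide_not, Bool.not_eq_true', decide_eq_false_iff_not]
    exact fun e => h.lk_ne_CD e.symm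
  · obtain ⟨l, hl, hjl⟩ := exists_leaf j'
    have hkl : T.Desc k l := ReflTransGen.head hj' hjl
    exact hit_iff.2 ⟨l, hl, hkl, hopen _ l (ReflTransGen.trans (desc_root k) hkl) fun hd =>
      hne (eq_of_out_of_desc hj' h hjl hd)⟩
  · obtain ⟨l, hl, hkl⟩ := exists_leaf (T.opp k)
    refine hit_opp.2 ⟨l, hl, hopen _ l hkl fun hd => not_desc_opp hkl ?_⟩
    exact ReflTransGen.trans (desc_root k) (ReflTransGen.head h hd)
  · have := ((outcome_mem_omegaAt ω j).1 hj).2.1.1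
    rw [open_iff_of_out h fun e => not_out_root (e ▸ h)] at this
    simp [ω] at this

theorem exists_mem_nbr_mem_omegaAt {k : V} (hk : ¬ T.Leaf k) {x : T.Outcome}
    (hx : x ∈ T.OmegaAt k) : ∃ j ∈ T.nbr k, x ∈ T.OmegaAt j := by
  obtain ⟨ω, rfl⟩ := mem_omega.1 (omegaAt_subset k hx)
  rw [outcome_mem_omegaAt] at hx
  obtain ⟨h1, ⟨h2, h3⟩, h4⟩ := hx
  obtain ⟨j, hj, hω, h3⟩ := (openLeaf_iff hk).1 h3
  refine ⟨j, mem_nbr.2 hj, (outcome_mem_omegaAt ω j).2 ⟨h1, ⟨?_, h3⟩, hj.opp_eq ▸ h4⟩⟩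
  rw [hj.root_eq]
  exact ReflTransGen.tail h2 ⟨hj, hω⟩

variable (T) in
/-- The total weight of the outcomes that show that a probe crossed `k`. -/
def total (w : T.Outcome → ℝ) (k : V) : ℝ := ∑ x ∈ T.OmegaAt k, w x

theorem total_pos {w : T.Outcome → ℝ} (hw : ∀ x ∈ T.Omega, 0 < w x) (k : V) : 0 < T.total w k :=
  Finset.sum_pos (fun x hx => hw x (omegaAt_subset k hx)) ⟨_, outcome_true_mem k⟩

/-- Each outcome that crosses `k` also crosses some outer neighbour, so the neighbours' sets cover
that of `k`. The cover is strictly redundant, because the outcome with all links working is counted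
at least twice. -/
theorem admissible_total {w : T.Outcome → ℝ} (hw : ∀ x ∈ T.Omega, 0 < w x) {k : V}
    (hk : ¬ T.Leaf k) : Admissible (T.total w k) (T.nbr k) (T.total w) := by
  have hw' : ∀ {k x}, x ∈ T.OmegaAt k → 0 < w x := fun hx => hw _ (omegaAt_subset _ hx)
  refine ⟨total_pos hw k, fun j _ => total_pos hw j, fun j hj => ?_, ?_⟩
  · rw [mem_nbr] at hj
    obtain ⟨x, hx, hxj⟩ := exists_mem_omegaAt_notMem hj
    exact Finset.sum_lt_sum_of_subset (omegaAt_mono (ReflTransGen.single hj)) hx hxj (hw' hx)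
      fun y hy _ => (hw' hy).le
  · have h1 : ∑ j ∈ T.nbr k, T.total w j =
        ∑ x ∈ T.OmegaAt k, ∑ j ∈ T.nbr k, if x ∈ T.OmegaAt j then w x else 0 := by
      rw [Finset.sum_comm]
      refine Finset.sum_congr rfl fun j hj => ?_
      rw [← Finset.sum_filter, total]
      congr 1
      ext x
      rw [Finset.mem_filter]
      exact ⟨fun h => ⟨omegaAt_mono (ReflTransGen.single (mem_nbr.1 hj)) h, h⟩, fun h => h.2⟩
    rw [h1]
    refine Finset.sum_lt_sum (fun x hx => ?_) ⟨_, outcome_true_mem k, ?_⟩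
    · obtain ⟨j, hj, hxj⟩ := exists_mem_nbr_mem_omegaAt hk hx
      have := Finset.single_le_sum (f := fun j => if x ∈ T.OmegaAt j then w x else 0)
        (fun i _ => by split_ifs; exacts [(hw' hx).le, le_rfl]) hj
      simpa only [hxj, if_true] using this
    · simp only [outcome_true_mem, if_true, Finset.sum_const, nsmul_eq_mul]
      have hpos := hw' (outcome_true_mem k)
      have h2 := two_le_ncard_out hk
      rw [Set.ncard_eq_toFinset_card'] at h2
      have h3 : {j | T.Out k j}.toFinset = T.nbr k := by ext; simp [mem_nbr]
      rw [h3] at h2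
      have : (2 : ℝ) ≤ (T.nbr k).card := by exact_mod_cast h2
      nlinarith

/-- The success probabilities up to `k` solve the equation of `IsRoot`. -/
theorem isRoot_reach {α : T.E → ℝ} (hα : α ∈ T.Param) {k : V} (hk : ¬ T.Leaf k)
    (hr : 0 < T.reach α k) : IsRoot (T.gam α k) (T.nbr k) (T.gam α) (T.reach α k) := by
  constructor
  · rw [gam_eq]
    exact mul_le_of_le_one_right hr.le (beta_pos_le hα k).2
  · rw [gam_eq, mul_div_cancel_left₀ _ hr.ne', beta_eq α hk, sub_sub_cancel]
    refine Finset.prod_congr rfl fun j hj => ?_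
    rw [gam_eq, reach_out α (mem_nbr.1 hj), pass]
    field_simp

theorem reach_pos {α : T.E → ℝ} (hα : α ∈ T.Param) (k : V) : 0 < T.reach α k := by
  induction k using (wf_out (T := T)).induction with
  | _ k ih =>
    by_cases h : ∃ p, T.Out p k
    · obtain ⟨p, hp⟩ := h
      rw [reach_out α hp]
      exact mul_pos (hα _).1 (ih p hp)
    · rw [exists_out_iff] at h
      by_cases hC : k = T.C
      · rw [hC, reach_C]
        exact mul_pos (hα _).1 (beta_pos_le hα _).1
      · rw [show k = T.D by tauto, reach_D]
        exact mul_pos (hα _).1 (beta_pos_le hα _).1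

theorem reach_mul_reach_div {α : T.E → ℝ} (hα : α ∈ T.Param) :
    T.reach α T.C * T.reach α T.D / T.gam α T.C = α T.CD := by
  have h1 := (hα T.CD).1
  have h2 := (beta_pos_le hα T.C).1
  have h3 := (beta_pos_le hα T.D).1
  rw [gam_eq, reach_C, reach_D]
  field_simp

end

noncomputable section

open scoped Classical
open Filter Topology

/-! ### Dependence of expectations on the parameters -/

section Expectation

variable {ι : Type*} [Fintype ι]

theorem continuous_expect (f : (ι → Bool) → ℝ) : Continuous fun α : ι → ℝ => expect α f := by
  refine continuous_finsetSum _ fun ω _ => continuous_const.mul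
    (continuous_finsetProd _ fun i _ => ?_)
  split_ifs
  · exact continuous_apply i
  · exact continuous_const.sub (continuous_apply i)

theorem differentiable_expect_update (f : (ι → Bool) → ℝ) (α : ι → ℝ) (e : ι) :
    Differentiable ℝ fun t => expect (Function.update α e t) f := by
  refine Differentiable.fun_sum fun ω _ => (differentiable_const _).mul ?_
  refine Differentiable.fun_finsetProd fun i _ => ?_
  by_cases hi : i = e
  · subst hi
    simp only [Function.update_self]
    split_ifs
    · exact differentiable_id
    · exact (differentiable_const _).sub differentiable_id
  · simp only [Function.update_of_ne hi]
    exact differentiable_const _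

theorem expect_mono {α : ι → ℝ} (hα : ∀ i, 0 ≤ α i ∧ α i ≤ 1) {f g : (ι → Bool) → ℝ}
    (h : ∀ ω, f ω ≤ g ω) : expect α f ≤ expect α g := by
  refine Finset.sum_le_sum fun ω _ => mul_le_mul_of_nonneg_right (h ω) ?_
  refine Finset.prod_nonneg fun i _ => ?_
  split_ifs
  · exact (hα i).1
  · linarith [(hα i).2]

end Expectation

/-! ### Gibbs' inequality -/

/-- Apply `log t ≤ t - 1` to the ratios `q x / p x`; the inequality is strict unless the ratio is 1.
-/
theorem gibbs {κ : Type*} {s : Finset κ} {p q : κ → ℝ} (hp : ∀ x ∈ s, 0 < p x)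
    (hq : ∀ x ∈ s, 0 < q x) (hpq : ∑ x ∈ s, q x ≤ ∑ x ∈ s, p x) :
    ∑ x ∈ s, p x * Real.log (q x) ≤ ∑ x ∈ s, p x * Real.log (p x) ∧
      (∑ x ∈ s, p x * Real.log (q x) = ∑ x ∈ s, p x * Real.log (p x) → ∀ x ∈ s, q x = p x) := by
  have h1 : ∀ x ∈ s, p x * Real.log (q x) ≤ p x * Real.log (p x) + (q x - p x) := by
    intro x hx
    have h := Real.log_le_sub_one_of_pos (div_pos (hq x hx) (hp x hx))
    rw [Real.log_div (hq x hx).ne' (hp x hx).ne'] at h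
    have h2 := mul_le_mul_of_nonneg_left h (hp x hx).le
    have h3 : p x * (q x / p x - 1) = q x - p x := by
      have := (hp x hx).ne'
      field_simp
    rw [h3] at h2
    linarith
  have h2 := Finset.sum_le_sum h1
  rw [Finset.sum_add_distrib, Finset.sum_sub_distrib] at h2
  refine ⟨by linarith, fun he x hx => by_contra fun hne => ?_⟩
  have h3 : p x * Real.log (q x) < p x * Real.log (p x) + (q x - p x) := by
    have hp' := (hp x hx).ne'
    have h := Real.log_lt_sub_one_of_pos (div_pos (hq x hx) (hp x hx))
      (fun e => hne ((div_eq_one_iff_eq hp').1 e))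
    rw [Real.log_div (hq x hx).ne' hp'] at h
    have h2 := mul_lt_mul_of_pos_left h (hp x hx)
    have h3 : p x * (q x / p x - 1) = q x - p x := by field_simp
    rw [h3] at h2
    linarith
  have h4 := Finset.sum_lt_sum h1 ⟨x, hx, h3⟩
  rw [Finset.sum_add_distrib, Finset.sum_sub_distrib] at h4
  linarith

variable {V : Type*} {T : TreeNetwork V} [Fintype V]

theorem prob_eq_expect (α : T.E → ℝ) (x : T.Outcome) :
    T.prob α x = expect α fun ω => ind (T.outcome ω = x) := by
  have := sum_prob α {x}
  simpa using this

theorem continuous_prob (x : T.Outcome) : Continuous fun α => T.prob α x := by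
  rw [show (fun α => T.prob α x) = fun α => expect α fun ω => ind (T.outcome ω = x) from
    funext fun α => prob_eq_expect α x]
  exact continuous_expect _

theorem differentiable_prob_update (α : T.E → ℝ) (e : T.E) (x : T.Outcome) :
    Differentiable ℝ fun t => T.prob (Function.update α e t) x := by
  rw [show (fun t => T.prob (Function.update α e t) x) = fun t =>
    expect (Function.update α e t) fun ω => ind (T.outcome ω = x) from
    funext fun t => prob_eq_expect _ x]
  convert differentiable_expect_update (fun ω => ind (T.outcome ω = x)) α e

theorem prob_nonneg {α : T.E → ℝ} (hα : α ∈ T.Param) (x : T.Outcome) : 0 ≤ T.prob α x := by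
  have h := expect_mono (fun i => ⟨(hα i).1.le, (hα i).2⟩) (f := fun _ => 0)
    (g := fun ω => ind (T.outcome ω = x)) fun ω => by unfold ind; split_ifs <;> simp
  rwa [expect_const, ← prob_eq_expect] at h

theorem beta_congr {α α' : T.E → ℝ} (k : V) (h : ∀ e ∈ T.behind k, α e = α' e) :
    T.beta α k = T.beta α' k := by
  induction k using (wf_out_swap (T := T)).induction with
  | _ k ih =>
    by_cases hk : T.Leaf k
    · rw [beta_leaf α hk, beta_leaf α' hk]
    · rw [beta_eq α hk, beta_eq α' hk]
      congr 1
      refine Finset.prod_congr rfl fun j hj => ?_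
      rw [mem_nbr] at hj
      rw [pass, pass, h _ ⟨k, j, .refl, hj, rfl⟩, ih j hj]
      rintro e ⟨p, i, hp, hpi, rfl⟩
      exact h _ ⟨p, i, ReflTransGen.head hj hp, hpi, rfl⟩

/-! ### The log-likelihood -/

/-- The parameters, possibly greater than one, at which the factors of all probabilities of outcomes
are positive. -/
structure Regular (α : T.E → ℝ) : Prop where
  pos_CD : 0 < α T.CD
  pos : ∀ j ∈ T.inner, 0 < α (T.lk j)
  pass_lt : ∀ j ∈ T.inner, T.pass α j < 1
  gam_lt : T.gam α T.C < 1

theorem Regular.prob_pos {α : T.E → ℝ} (h : Regular α) {x : T.Outcome} (hx : x ∈ T.Omega) :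
    0 < T.prob α x := by
  by_cases h0 : x = 0
  · rw [h0, prob_zero, sub_pos]
    exact h.gam_lt
  · rw [prob_eq α ((mem_omegaAt_C hx).2 h0)]
    refine mul_pos h.pos_CD (Finset.prod_pos fun j hj => ?_)
    split_ifs
    · exact h.pos j hj
    · exact sub_pos.2 (h.pass_lt j hj)
    · exact one_pos

/-- If the passage through `j` were certain, an outcome that crosses `par j` but not `j` would have
probability zero. -/
theorem regular_of_prob_pos {α : T.E → ℝ} (hα : α ∈ T.Param)
    (h : ∀ x ∈ T.Omega, 0 < T.prob α x) : Regular α := by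
  refine ⟨(hα _).1, fun j _ => (hα _).1, fun j hj => ?_, ?_⟩
  · refine lt_of_le_of_ne (pass_pos_le hα (beta_pos_le hα j)).2 fun e => ?_
    obtain ⟨x, hx, hxj⟩ := exists_mem_omegaAt_notMem (out_par hj)
    have h1 := h x (omegaAt_subset _ hx)
    rw [prob_eq α (omegaAt_root_subset _ hx), Finset.prod_eq_zero hj] at h1
    · simp at h1
    · rw [if_neg hxj, if_pos hx, e, sub_self]
  · have := h 0 zero_mem_omega
    rw [prob_zero] at this
    linarith

/-- Regularity is open even at entries equal to 1, so the product formulas hold on a two-sided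
neighbourhood and can be differentiated there. -/
theorem eventually_regular {α : T.E → ℝ} (h : Regular α) : ∀ᶠ α' in 𝓝 α, Regular α' := by
  have hpass : ∀ j, Continuous fun α : T.E → ℝ => T.pass α j := fun j =>
    (continuous_apply _).mul (continuous_expect _)
  have hgam : Continuous fun α : T.E → ℝ => T.gam α T.C :=
    continuous_finsetSum _ fun x _ => continuous_prob x
  have h1 := (continuous_apply (A := fun _ => ℝ) T.CD).continuousAt.eventually
    (lt_mem_nhds (α := ℝ) (a := 0) (b := α T.CD) h.pos_CD)
  have h2 : ∀ᶠ α' in 𝓝 α, ∀ j ∈ T.inner, 0 < α' (T.lk j) :=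
    (Finset.eventually_all T.inner).2 fun j hj =>
      (continuous_apply (A := fun _ => ℝ) (T.lk j)).continuousAt.eventually
        (lt_mem_nhds (α := ℝ) (a := 0) (b := α (T.lk j)) (h.pos j hj))
  have h3 : ∀ᶠ α' in 𝓝 α, ∀ j ∈ T.inner, T.pass α' j < 1 :=
    (Finset.eventually_all T.inner).2 fun j hj =>
      (hpass j).continuousAt.eventually (gt_mem_nhds (h.pass_lt j hj))
  have h4 := hgam.continuousAt.eventually (gt_mem_nhds h.gam_lt)
  filter_upwards [h1, h2, h3, h4] with α' h1 h2 h3 h4 using ⟨h1, h2, h3, h4⟩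

theorem eventually_regular_update {α : T.E → ℝ} (h : Regular α) (e : T.E) :
    ∀ᶠ t in 𝓝 (α e), Regular (Function.update α e t) := by
  have hc : Continuous fun t : ℝ => Function.update α e t := continuous_const.update e continuous_id
  have := hc.tendsto (α e)
  rw [Function.update_eq_self] at this
  exact this.eventually (eventually_regular h)

/-- If the weights have the sum zero, then their log-likelihood depends on them only through the
totals of the sets `OmegaAt k`. -/
theorem sum_mul_log_prob {α : T.E → ℝ} (h : Regular α) {w : T.Outcome → ℝ}
    (hw : ∑ x ∈ T.Omega, w x = 0) :
    ∑ x ∈ T.Omega, w x * Real.log (T.prob α x) =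
      T.total w T.C * (Real.log (α T.CD) - Real.log (1 - T.gam α T.C)) +
        ∑ j ∈ T.inner, (T.total w j * Real.log (α (T.lk j)) +
          (T.total w (T.par j) - T.total w j) * Real.log (1 - T.pass α j)) := by
  have h1 : ∀ x ∈ T.OmegaAt T.C, Real.log (T.prob α x) = Real.log (α T.CD) +
      ∑ j ∈ T.inner, (ind (x ∈ T.OmegaAt j) * Real.log (α (T.lk j)) +
        (ind (x ∈ T.OmegaAt (T.par j)) - ind (x ∈ T.OmegaAt j)) *
          Real.log (1 - T.pass α j)) := by
    intro x hx
    have h0 : ∀ j ∈ T.inner, (if x ∈ T.OmegaAt j then α (T.lk j)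
        else if x ∈ T.OmegaAt (T.par j) then 1 - T.pass α j else 1) ≠ 0 := by
      intro j hj
      split_ifs
      · exact (h.pos j hj).ne'
      · exact (sub_pos.2 (h.pass_lt j hj)).ne'
      · exact one_ne_zero
    rw [prob_eq α hx, Real.log_mul h.pos_CD.ne' (Finset.prod_ne_zero_iff.2 h0), Real.log_prod h0]
    congr 1
    refine Finset.sum_congr rfl fun j hj => ?_
    by_cases h2 : x ∈ T.OmegaAt j
    · have h3 := omegaAt_mono (ReflTransGen.single (out_par hj)) h2
      simp [h2, h3, ind]
    · by_cases h3 : x ∈ T.OmegaAt (T.par j) <;> simp [h2, h3, ind]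
  have h2 : ∀ k, ∑ x ∈ T.OmegaAt T.C, w x * ind (x ∈ T.OmegaAt k) = T.total w k := by
    intro k
    simp only [ind, mul_ite, mul_one, mul_zero]
    rw [← Finset.sum_filter, total]
    congr 1
    ext x
    rw [Finset.mem_filter]
    exact ⟨fun h => h.2, fun h => ⟨omegaAt_root_subset k h, h⟩⟩
  rw [sum_omega] at hw ⊢
  -- The weights have sum zero, so the zero outcome contributes through the total at `C` as well.
  have h3 : w 0 = - T.total w T.C := by unfold total; linarith
  rw [h3, prob_zero, Finset.sum_congr rfl fun x hx => by rw [h1 x hx]]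
  simp only [mul_add, Finset.sum_add_distrib, Finset.mul_sum]
  rw [← Finset.sum_mul, Finset.sum_comm, Finset.sum_comm (s := T.OmegaAt T.C)]
  have h4 : ∀ j, ∑ x ∈ T.OmegaAt T.C, w x * (ind (x ∈ T.OmegaAt j) * Real.log (α (T.lk j))) =
      T.total w j * Real.log (α (T.lk j)) := by
    intro j
    rw [← h2 j, Finset.sum_mul]
    exact Finset.sum_congr rfl fun x _ => by ring
  have h5 : ∀ j, ∑ x ∈ T.OmegaAt T.C, w x * ((ind (x ∈ T.OmegaAt (T.par j)) -
      ind (x ∈ T.OmegaAt j)) * Real.log (1 - T.pass α j)) =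
      (T.total w (T.par j) - T.total w j) * Real.log (1 - T.pass α j) := by
    intro j
    rw [← h2 j, ← h2 (T.par j), ← Finset.sum_sub_distrib, Finset.sum_mul]
    exact Finset.sum_congr rfl fun x _ => by ring
  simp only [h4, h5]
  unfold total
  ring

/-! ### The score and the totals it determines. -/

variable (T) in
/-- The log-likelihood for data with the weights `w`. -/
def logLik (w : T.Outcome → ℝ) (α : T.E → ℝ) : ℝ := ∑ x ∈ T.Omega, w x * Real.log (T.prob α x)

theorem logLik_sub (w w' : T.Outcome → ℝ) (α : T.E → ℝ) :
    T.logLik (w - w') α = T.logLik w α - T.logLik w' α := by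
  simp only [logLik, Pi.sub_apply, sub_mul, Finset.sum_sub_distrib]

theorem total_sub (w w' : T.Outcome → ℝ) (k : V) :
    T.total (w - w') k = T.total w k - T.total w' k := by
  simp only [total, Pi.sub_apply, Finset.sum_sub_distrib]

/-- The expected score vanishes. -/
theorem hasDerivAt_logLik_prob {α : T.E → ℝ} (h : Regular α) (e : T.E) :
    HasDerivAt (fun t => T.logLik (T.prob α) (Function.update α e t)) 0 (α e) := by
  set d : T.Outcome → ℝ := fun x => deriv (fun t => T.prob (Function.update α e t) x) (α e)
  have hd : ∀ x, HasDerivAt (fun t => T.prob (Function.update α e t) x) (d x) (α e) := fun x =>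
    (differentiable_prob_update α e x (α e)).hasDerivAt
  -- The probabilities sum to 1 for every real parameter vector, so their derivatives sum to zero.
  have h0 : ∑ x ∈ T.Omega, d x = 0 := by
    have h1 := HasDerivAt.fun_sum fun x (_ : x ∈ T.Omega) => hd x
    simp only [sum_prob_omega] at h1
    exact h1.unique (hasDerivAt_const _ _)
  have h1 : HasDerivAt (fun t => T.logLik (T.prob α) (Function.update α e t))
      (∑ x ∈ T.Omega, T.prob α x * (d x / T.prob α x)) (α e) := by
    refine HasDerivAt.fun_sum fun x hx => HasDerivAt.const_mul _ ?_
    have h2 := (hd x).log (by rw [Function.update_eq_self]; exact (h.prob_pos hx).ne')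
    rwa [Function.update_eq_self] at h2
  rwa [Finset.sum_congr rfl fun x hx => mul_div_cancel₀ (d x) (h.prob_pos hx).ne', h0] at h1

theorem gam_C_eq (α : T.E → ℝ) : T.gam α T.C = α T.CD * (T.beta α T.D * T.beta α T.C) := by
  rw [gam_eq, reach_C, mul_assoc]

theorem beta_update {α : T.E → ℝ} {e : T.E} {k : V} (h : e ∉ T.behind k) (t : ℝ) :
    T.beta (Function.update α e t) k = T.beta α k :=
  beta_congr k fun e' he' => Function.update_of_ne (fun hne : e' = e => h (hne ▸ he')) _ _

theorem pass_update {α : T.E → ℝ} {e : T.E} {j : V} (h : e ∉ T.onward j) (t : ℝ) :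
    T.pass (Function.update α e t) j = T.pass α j := by
  rw [pass, pass, beta_update fun he => h (behind_subset_onward j he),
    Function.update_of_ne fun hne => h ⟨j, .refl, hne.symm⟩]

omit [Fintype V] in
theorem CD_notMem_behind (k : V) : T.CD ∉ T.behind k := by
  rintro ⟨p, i, -, hpi, e⟩
  exact hpi.lk_ne_CD e.symm

theorem CD_notMem_onward {j : V} (hj : j ∈ T.inner) : T.CD ∉ T.onward j := by
  rintro ⟨i, hi, e⟩
  obtain ⟨q, hq⟩ := (out_par hj).of_desc hi
  exact hq.lk_ne_CD e.symm

/-- The derivative of `a * (log t - log (1 - t * b))` vanishes only if `a = 0`. -/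
theorem eq_zero_of_hasDerivAt {a b t₀ c : ℝ} {f : ℝ → ℝ} (ht : 0 < t₀) (hb : 0 ≤ b)
    (htb : t₀ * b < 1) (hf : ∀ᶠ t in 𝓝 t₀, f t = a * (Real.log t - Real.log (1 - t * b)) + c)
    (hd : HasDerivAt f 0 t₀) : a = 0 := by
  have h1 : HasDerivAt (fun t => a * (Real.log t - Real.log (1 - t * b)) + c)
      (a * (1 / t₀ - -(1 * b) / (1 - t₀ * b))) t₀ := by
    refine HasDerivAt.add_const c (HasDerivAt.const_mul a (HasDerivAt.sub ?_ ?_))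
    · exact (hasDerivAt_id t₀).log ht.ne'
    · exact (((hasDerivAt_id t₀).mul_const b).const_sub 1).log (sub_pos.2 htb).ne'
  have h2 := (h1.congr_of_eventuallyEq hf).unique hd
  have h3 : 0 < 1 / t₀ - -(1 * b) / (1 - t₀ * b) := by
    have := sub_pos.2 htb
    rw [neg_div, sub_neg_eq_add, one_mul]
    positivity
  exact (mul_eq_zero.1 h2).resolve_right h3.ne'

theorem total_D (w : T.Outcome → ℝ) : T.total w T.D = T.total w T.C := by
  unfold total
  rw [omegaAt_C_eq]

/-- The score determines the totals of the sets `OmegaAt k`. -/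
theorem total_eq_zero_of_hasDerivAt {α : T.E → ℝ} (h : Regular α) (hα : α ∈ T.Param)
    {w : T.Outcome → ℝ} (hw : ∑ x ∈ T.Omega, w x = 0)
    (hd : ∀ e, HasDerivAt (fun t => T.logLik w (Function.update α e t)) 0 (α e)) (k : V) :
    T.total w k = 0 := by
  -- As a function of the `CD` entry alone, only `log α_CD` and `log (1 - γ_C)` vary.
  have hC : T.total w T.C = 0 := by
    refine eq_zero_of_hasDerivAt (b := T.beta α T.D * T.beta α T.C)
      (c := ∑ j ∈ T.inner, (T.total w j * Real.log (α (T.lk j)) +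
          (T.total w (T.par j) - T.total w j) * Real.log (1 - T.pass α j))) h.pos_CD
      (mul_pos (beta_pos_le hα _).1 (beta_pos_le hα _).1).le ?_ ?_ (hd T.CD)
    · rw [← gam_C_eq]
      exact h.gam_lt
    · filter_upwards [eventually_regular_update h T.CD] with t ht
      rw [logLik, sum_mul_log_prob ht hw, gam_C_eq, beta_update (CD_notMem_behind _),
        beta_update (CD_notMem_behind _), Function.update_self]
      congr 1
      refine Finset.sum_congr rfl fun j hj => ?_
      rw [pass_update (CD_notMem_onward hj), Function.update_of_ne (out_par hj).lk_ne_CD]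
  -- The transitive closure supplies the hypothesis at all nodes between the root and `k`, not just
  -- at the inner neighbour.
  induction k using (wf_out (T := T)).transGen.induction with
  | _ k ih =>
    by_cases hp : ∃ p, T.Out p k
    swap
    · rw [exists_out_iff] at hp
      by_cases hkC : k = T.C
      · rwa [hkC]
      · rwa [show k = T.D by tauto, total_D]
    have hk := mem_inner.2 hp
    obtain ⟨p, hp⟩ := hp
    refine eq_zero_of_hasDerivAt (b := T.beta α k)
      (c := ∑ j ∈ T.inner.erase k, (T.total w j * Real.log (α (T.lk j)) +
          (T.total w (T.par j) - T.total w j) * Real.log (1 - T.pass α j))) (h.pos k hk)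
      (beta_pos_le hα _).1.le (h.pass_lt k hk) ?_ (hd (T.lk k))
    filter_upwards [eventually_regular_update h (T.lk k)] with t ht
    rw [logLik, sum_mul_log_prob ht hw, hC, zero_mul, zero_add, ← Finset.add_sum_erase _ _ hk]
    congr 1
    · rw [hp.par_eq, ih p (TransGen.single hp), pass, beta_update hp.lk_notMem_behind,
        Function.update_self]
      ring
    · refine Finset.sum_congr rfl fun j hj => ?_
      rw [Finset.mem_erase] at hj
      have hpj := out_par hj.2
      -- If `k` lies behind `j`, the totals at `j` and `par j` already vanish; otherwise the term of
      -- `j` does not involve the link of `k`.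
      by_cases hjk : T.Desc j k
      · have h1 : TransGen T.Out j k :=
          (reflTransGen_iff_eq_or_transGen.1 hjk).resolve_left fun e => hj.1 e.symm
        rw [ih j h1, ih _ (TransGen.head hpj h1)]
        ring
      · rw [pass_update, Function.update_of_ne fun e => hj.1 (hpj.lk_inj e)]
        rintro ⟨i, hi, e⟩
        exact hjk (hp.lk_inj e ▸ hi)

end

noncomputable section

open scoped Classical
open Filter Topology

variable {V : Type*} {T : TreeNetwork V} [Fintype V]

/-! ### The closed-form estimates -/

variable (T) in
/-- The solution of the equation for the success probability up to `k`. -/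
def rootSol (γ : V → ℝ) (k : V) : ℝ :=
  if T.Leaf k then γ k else Classical.epsilon (IsRoot (γ k) (T.nbr k) γ)

theorem rootSol_leaf (γ : V → ℝ) {k : V} (hk : T.Leaf k) : T.rootSol γ k = γ k := if_pos hk

theorem isRoot_rootSol {γ : V → ℝ} {k : V} (hk : ¬ T.Leaf k)
    (h : Admissible (γ k) (T.nbr k) γ) : IsRoot (γ k) (T.nbr k) γ (T.rootSol γ k) := by
  rw [rootSol, if_neg hk]
  exact Classical.epsilon_spec h.existsUnique.exists

theorem rootSol_eq {γ : V → ℝ} {k : V} {A : ℝ} (hk : ¬ T.Leaf k)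
    (h : Admissible (γ k) (T.nbr k) γ) (hA : IsRoot (γ k) (T.nbr k) γ A) : T.rootSol γ k = A :=
  h.existsUnique.unique (isRoot_rootSol hk h) hA

/-- The true `reach` solves the same equation, and the solution is unique. -/
theorem rootSol_gam {α : T.E → ℝ} (hα : α ∈ T.Param) (h : Regular α) (k : V) :
    T.rootSol (T.gam α) k = T.reach α k := by
  by_cases hk : T.Leaf k
  · rw [rootSol_leaf _ hk, gam_eq, beta_leaf α hk, mul_one]
  · exact rootSol_eq hk (admissible_total (fun x hx => h.prob_pos hx) hk)
      (isRoot_reach hα hk (reach_pos hα k))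

variable {n : T.Outcome → ℕ}

theorem Upper.gammaR_eq {k : V} (hk : T.Upper k) : T.gammaR n k = T.total (T.pHat n) k := by
  simp [gammaR, total, OmegaAt, hk]

theorem Lower.gammaM_eq {k : V} (hk : T.Lower k) : T.gammaM n k = T.total (T.pHat n) k := by
  simp [gammaM, total, OmegaAt, hk.not_upper]

theorem Upper.isRootR_eq {k : V} (hk : T.Upper k) :
    T.IsRootR n k = IsRoot (T.total (T.pHat n) k) (T.nbr k) (T.total (T.pHat n)) := by
  have h1 : T.parents k = T.nbr k := by
    ext j
    simp [parents, nbr, hk.out_iff]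
  ext A
  unfold IsRootR IsRoot
  rw [h1, hk.gammaR_eq, Finset.prod_congr rfl fun j hj => by
    rw [(hk.out (mem_nbr.1 hj)).gammaR_eq]]

theorem Lower.isRootM_eq {k : V} (hk : T.Lower k) :
    T.IsRootM n k = IsRoot (T.total (T.pHat n) k) (T.nbr k) (T.total (T.pHat n)) := by
  have h1 : T.children k = T.nbr k := by
    ext j
    simp [children, nbr, hk.out_iff]
  ext A
  unfold IsRootM IsRoot
  rw [h1, hk.gammaM_eq, Finset.prod_congr rfl fun j hj => by
    rw [(hk.out (mem_nbr.1 hj)).gammaM_eq]]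

theorem Upper.aHatR_eq {k : V} (hk : T.Upper k) :
    T.AHatR n k = T.rootSol (T.total (T.pHat n)) k := by
  simp only [AHatR, rootSol, hk.leaf_iff, hk.gammaR_eq, hk.isRootR_eq]

theorem Lower.aHatM_eq {k : V} (hk : T.Lower k) :
    T.AHatM n k = T.rootSol (T.total (T.pHat n)) k := by
  simp only [AHatM, rootSol, hk.leaf_iff, hk.gammaM_eq, hk.isRootM_eq]

theorem alphaHat_CD : T.alphaHat n T.CD = T.rootSol (T.total (T.pHat n)) T.C *
    T.rootSol (T.total (T.pHat n)) T.D / T.total (T.pHat n) T.C := by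
  rw [alphaHat, if_pos rfl, alphaHatCD, upper_C.aHatR_eq, lower_D.aHatM_eq, upper_C.gammaR_eq]

theorem Out.alphaHat_lk {p k : V} (h : T.Out p k) : T.alphaHat n (T.lk k) =
    T.rootSol (T.total (T.pHat n)) k / T.rootSol (T.total (T.pHat n)) p := by
  rw [alphaHat, if_neg h.lk_ne_CD]
  by_cases hp : T.Upper p
  · rw [h.lk_eq_of_upper hp, if_pos hp, (hp.out h).aHatR_eq, hp.aHatR_eq]
  · have hp := lower_of_not_upper hp
    rw [h.lk_eq_of_lower hp, if_neg (hp.out h).not_upper, (hp.out h).aHatM_eq, hp.aHatM_eq]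

variable (hn : ∀ x ∈ T.Omega, 0 < n x)

include hn

theorem sum_count_pos : 0 < ∑ x ∈ T.Omega, (n x : ℝ) :=
  Finset.sum_pos (fun x hx => Nat.cast_pos.2 (hn x hx)) ⟨0, zero_mem_omega⟩

theorem pHat_pos {x : T.Outcome} (hx : x ∈ T.Omega) : 0 < T.pHat n x :=
  div_pos (Nat.cast_pos.2 (hn x hx)) (sum_count_pos hn)

theorem sum_pHat : ∑ x ∈ T.Omega, T.pHat n x = 1 := by
  unfold pHat
  rw [← Finset.sum_div, div_self (sum_count_pos hn).ne']

theorem admissible_pHat {k : V} (hk : ¬ T.Leaf k) :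
    Admissible (T.total (T.pHat n) k) (T.nbr k) (T.total (T.pHat n)) :=
  admissible_total (fun _ hx => pHat_pos hn hx) hk

theorem total_C_pHat : T.total (T.pHat n) T.C = 1 - T.pHat n 0 := by
  have := sum_pHat hn
  rw [sum_omega] at this
  unfold total
  linarith

theorem total_le_rootSol (k : V) :
    T.total (T.pHat n) k ≤ T.rootSol (T.total (T.pHat n)) k := by
  by_cases hk : T.Leaf k
  · rw [rootSol_leaf _ hk]
  · exact (isRoot_rootSol hk (admissible_pHat hn hk)).1

theorem rootSol_pos (k : V) : 0 < T.rootSol (T.total (T.pHat n)) k :=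
  (total_pos (fun _ hx => pHat_pos hn hx) k).trans_le (total_le_rootSol hn k)

theorem alphaHat_pos (e : T.E) : 0 < T.alphaHat n e := by
  rcases eq_CD_or_exists_lk e with rfl | ⟨p, k, h, rfl⟩
  · rw [alphaHat_CD]
    exact div_pos (mul_pos (rootSol_pos hn _) (rootSol_pos hn _))
      (total_pos (fun _ hx => pHat_pos hn hx) _)
  · rw [h.alphaHat_lk]
    exact div_pos (rootSol_pos hn _) (rootSol_pos hn _)

/-- By induction from the leaves, the passage probability through `j` is the observed total at `j`
divided by the root at `k`, so the recursion for `beta` is the defining equation of the root. -/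
theorem beta_alphaHat (k : V) : T.beta (T.alphaHat n) k =
    T.total (T.pHat n) k / T.rootSol (T.total (T.pHat n)) k := by
  induction k using (wf_out_swap (T := T)).induction with
  | _ k ih =>
    by_cases hk : T.Leaf k
    · rw [beta_leaf _ hk, rootSol_leaf _ hk, div_self]
      exact (total_pos (fun _ hx => pHat_pos hn hx) k).ne'
    · have h := (isRoot_rootSol hk (admissible_pHat hn hk)).2
      rw [beta_eq _ hk, sub_eq_iff_eq_add, ← sub_eq_iff_eq_add', h]
      refine Finset.prod_congr rfl fun j hj => ?_
      rw [mem_nbr] at hj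
      rw [pass, ih j hj, hj.alphaHat_lk]
      have h1 := (rootSol_pos hn j).ne'
      have h2 := (rootSol_pos hn k).ne'
      field_simp

/-- The quotients telescope along the path from the root; at `C` and `D` the value of `alphaHat` at
`CD` is exactly what makes this correct. -/
theorem reach_alphaHat (k : V) :
    T.reach (T.alphaHat n) k = T.rootSol (T.total (T.pHat n)) k := by
  have hC := (rootSol_pos hn T.C).ne'
  have hD := (rootSol_pos hn T.D).ne'
  have hg := (total_pos (fun _ hx => pHat_pos hn hx) T.C).ne'
  induction k using (wf_out (T := T)).induction with
  | _ k ih =>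
    by_cases h : ∃ p, T.Out p k
    · obtain ⟨p, hp⟩ := h
      rw [reach_out _ hp, ih p hp, hp.alphaHat_lk]
      exact div_mul_cancel₀ _ (rootSol_pos hn p).ne'
    · rw [exists_out_iff] at h
      by_cases hkC : k = T.C
      · rw [hkC, reach_C, alphaHat_CD, beta_alphaHat hn, total_D]
        field_simp
      · rw [show k = T.D by tauto, reach_D, alphaHat_CD, beta_alphaHat hn]
        field_simp

theorem gam_alphaHat (k : V) : T.gam (T.alphaHat n) k = T.total (T.pHat n) k := by
  rw [gam_eq, reach_alphaHat hn, beta_alphaHat hn, mul_div_cancel₀ _ (rootSol_pos hn k).ne']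

theorem regular_alphaHat : Regular (T.alphaHat n) := by
  refine ⟨alphaHat_pos hn _, fun j _ => alphaHat_pos hn _, fun j hj => ?_, ?_⟩
  · have h := out_par hj
    have hk : ¬ T.Leaf (T.par j) := fun hl => hl j h
    rw [pass, beta_alphaHat hn, h.alphaHat_lk, div_mul_div_cancel₀' (rootSol_pos hn j).ne',
      div_lt_one (rootSol_pos hn _)]
    exact ((admissible_pHat hn hk).lt_of_mem j (mem_nbr.2 h)).trans_le (total_le_rootSol hn _)
  · rw [gam_alphaHat hn, total_C_pHat hn]
    linarith [pHat_pos hn zero_mem_omega]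

theorem alphaHat_mem_param (h : ∀ e, T.alphaHat n e ≤ 1) : T.alphaHat n ∈ T.Param := fun e =>
  ⟨alphaHat_pos hn e, h e⟩

/-! ### Maximum likelihood -/

theorem logLikelihood_eq (α : T.E → ℝ) :
    T.logLikelihood n α = (∑ x ∈ T.Omega, (n x : ℝ)) * T.logLik (T.pHat n) α := by
  have := (sum_count_pos hn).ne'
  unfold logLikelihood logLik pHat
  rw [Finset.mul_sum]
  refine Finset.sum_congr rfl fun x _ => ?_
  field_simp

/-- If the model at `α` has the observed totals, then its probabilities can replace the observed
proportions in the log-likelihood. -/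
theorem logLik_pHat_eq {α α' : T.E → ℝ} (hg : ∀ k, T.gam α k = T.total (T.pHat n) k)
    (h' : Regular α') : T.logLik (T.pHat n) α' = T.logLik (T.prob α) α' := by
  have hw : ∑ x ∈ T.Omega, (T.pHat n - T.prob α) x = 0 := by
    simp only [Pi.sub_apply, Finset.sum_sub_distrib, sum_pHat hn, sum_prob_omega, sub_self]
  have h0 : ∀ k, T.total (T.pHat n - T.prob α) k = 0 := fun k => by
    rw [total_sub, ← hg k, gam, total, sub_self]
  have := sum_mul_log_prob h' hw
  simp only [h0, sub_self, zero_mul, add_zero, Finset.sum_const_zero] at this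
  rw [← sub_eq_zero, ← logLik_sub]
  exact this

/-- Subtracting the expected score gives the weights `pHat - prob α`, which have sum zero and
vanishing score, so all their totals are zero. -/
theorem gam_eq_of_solvesLikelihoodEq {α : T.E → ℝ} (h : T.SolvesLikelihoodEq n α) (k : V) :
    T.gam α k = T.total (T.pHat n) k := by
  obtain ⟨hα, hpos, hd⟩ := h
  have hr := regular_of_prob_pos hα hpos
  have hw : ∑ x ∈ T.Omega, (T.pHat n - T.prob α) x = 0 := by
    simp only [Pi.sub_apply, Finset.sum_sub_distrib, sum_pHat hn, sum_prob_omega, sub_self]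
  have hN := (sum_count_pos hn).ne'
  have h0 := total_eq_zero_of_hasDerivAt hr hα hw (fun e => ?_) k
  · rw [total_sub] at h0
    exact (sub_eq_zero.1 h0).symm
  · have h1 := ((hd e).const_mul (∑ x ∈ T.Omega, (n x : ℝ))⁻¹).sub (hasDerivAt_logLik_prob hr e)
    rw [mul_zero, sub_zero] at h1
    refine h1.congr_of_eventuallyEq (Eventually.of_forall fun t => ?_)
    simp only [Pi.sub_apply, logLik_sub, logLikelihood_eq hn, inv_mul_cancel_left₀ hN]

theorem solvesLikelihoodEq_of_gam_eq {α : T.E → ℝ} (hα : α ∈ T.Param) (hr : Regular α)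
    (hg : ∀ k, T.gam α k = T.total (T.pHat n) k) : T.SolvesLikelihoodEq n α := by
  refine ⟨hα, fun x hx => hr.prob_pos hx, fun e => ?_⟩
  have h1 := (hasDerivAt_logLik_prob hr e).const_mul (∑ x ∈ T.Omega, (n x : ℝ))
  rw [mul_zero] at h1
  refine h1.congr_of_eventuallyEq ?_
  filter_upwards [eventually_regular_update hr e] with t ht
  rw [logLikelihood_eq hn, logLik_pHat_eq hn hg ht]

omit hn in
theorem likelihood_pos {α : T.E → ℝ} (hr : Regular α) : 0 < T.likelihood n α :=
  Finset.prod_pos fun _ hx => pow_pos (hr.prob_pos hx) _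

omit hn in
theorem log_likelihood {α : T.E → ℝ} (hr : Regular α) :
    Real.log (T.likelihood n α) = T.logLikelihood n α := by
  unfold likelihood logLikelihood
  rw [Real.log_prod fun x hx => (pow_pos (hr.prob_pos hx) _).ne']
  simp only [Real.log_pow]

theorem regular_of_likelihood_pos {α : T.E → ℝ} (hα : α ∈ T.Param)
    (h : 0 < T.likelihood n α) : Regular α := by
  refine regular_of_prob_pos hα fun x hx => lt_of_le_of_ne (prob_nonneg hα x) fun e => ?_
  rw [likelihood, Finset.prod_eq_zero hx] at h
  · exact lt_irrefl _ h
  · rw [← e, zero_pow (hn x hx).ne']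

/-- With matching totals, both log-likelihoods are cross-entropies relative to `prob α`, so Gibbs'
inequality and its equality case apply. A parameter of likelihood zero is harmless because the
likelihood at `α` is positive. -/
theorem likelihood_le {α α' : T.E → ℝ} (hr : Regular α)
    (hg : ∀ k, T.gam α k = T.total (T.pHat n) k) (hα' : α' ∈ T.Param) :
    T.likelihood n α' ≤ T.likelihood n α ∧
      (T.likelihood n α' = T.likelihood n α → ∀ k, T.gam α' k = T.gam α k) := by
  have hpos := likelihood_pos (n := n) hr
  by_cases h0 : 0 < T.likelihood n α'
  · have hr' := regular_of_likelihood_pos hn hα' h0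
    have hN := sum_count_pos hn
    have hgibbs := gibbs (fun x hx => hr.prob_pos hx) (fun x hx => hr'.prob_pos hx)
      ((sum_prob_omega α').trans (sum_prob_omega α).symm).le
    have key : ∀ {β}, Regular β → Real.log (T.likelihood n β) =
        (∑ x ∈ T.Omega, (n x : ℝ)) * ∑ x ∈ T.Omega, T.prob α x * Real.log (T.prob β x) := by
      intro β hβ
      rw [log_likelihood hβ, logLikelihood_eq hn, logLik_pHat_eq hn hg hβ, logLik]
    constructor
    · rw [← Real.log_le_log_iff h0 hpos, key hr', key hr]
      exact mul_le_mul_of_nonneg_left hgibbs.1 hN.le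
    · intro e k
      have h1 := congrArg Real.log e
      rw [key hr', key hr] at h1
      exact Finset.sum_congr rfl fun x hx =>
        hgibbs.2 (mul_left_cancel₀ hN.ne' h1) x (omegaAt_subset k hx)
  · exact ⟨(not_lt.1 h0).trans hpos.le, fun e => absurd (e.symm.subst (motive := (0 < ·)) hpos) h0⟩

theorem isMLE_of_gam_eq {α : T.E → ℝ} (hα : α ∈ T.Param) (hr : Regular α)
    (hg : ∀ k, T.gam α k = T.total (T.pHat n) k) : T.IsMLE n α :=
  ⟨hα, fun _ hα' => (likelihood_le hn hr hg hα').1⟩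

omit hn in
theorem apply_CD_of_gam_eq {α : T.E → ℝ} (hα : α ∈ T.Param) (hr : Regular α)
    (hg : ∀ k, T.gam α k = T.total (T.pHat n) k) :
    α T.CD = T.AHatR n T.C * T.AHatM n T.D / T.gammaR n T.C := by
  have hg' : T.gam α = T.total (T.pHat n) := funext hg
  rw [upper_C.aHatR_eq, lower_D.aHatM_eq, upper_C.gammaR_eq, ← hg', rootSol_gam hα hr,
    rootSol_gam hα hr, reach_mul_reach_div hα]

/-- One parameter that matches the totals forces every maximizer to match them, with no appeal to
derivatives, which need not vanish at a maximizer on the boundary. -/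
theorem gam_eq_of_isMLE {α α' : T.E → ℝ} (hα : α ∈ T.Param) (hr : Regular α)
    (hg : ∀ k, T.gam α k = T.total (T.pHat n) k) (h : T.IsMLE n α') :
    Regular α' ∧ ∀ k, T.gam α' k = T.total (T.pHat n) k := by
  have h1 := likelihood_le hn hr hg h.1
  have h2 : T.likelihood n α' = T.likelihood n α := le_antisymm h1.1 (h.2 hα)
  exact ⟨regular_of_likelihood_pos hn h.1 (h2.symm.subst (motive := (0 < ·)) (likelihood_pos hr)),
    fun k => (h1.2 h2 k).trans (hg k)⟩

omit hn

/-! ### Asymptotics -/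

theorem regular_of_lt_one {α : T.E → ℝ} (hα : ∀ e, 0 < α e ∧ α e < 1) : Regular α := by
  have hP : α ∈ T.Param := fun e => ⟨(hα e).1, (hα e).2.le⟩
  have hb := beta_pos_le hP
  refine ⟨(hα _).1, fun j _ => (hα _).1, fun j _ => ?_, ?_⟩
  · exact mul_lt_one_of_nonneg_of_lt_one_left (hα _).1.le (hα _).2 (hb j).2
  · rw [gam_C_eq]
    exact mul_lt_one_of_nonneg_of_lt_one_left (hα _).1.le (hα _).2
      (mul_le_one₀ (hb _).2 (hb _).1.le (hb _).2)

theorem tendsto_rootSol {α : T.E → ℝ} (hα : α ∈ T.Param) (hr : Regular α) (k : V) :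
    Tendsto (fun γ => T.rootSol γ k) (𝓝 (T.gam α)) (𝓝 (T.reach α k)) := by
  have hγ : ∀ j, Tendsto (fun γ : V → ℝ => γ j) (𝓝 (T.gam α)) (𝓝 (T.gam α j)) := fun j =>
    (continuous_apply j).tendsto _
  by_cases hk : T.Leaf k
  · simp only [rootSol_leaf _ hk]
    have := hγ k
    rwa [gam_eq, beta_leaf α hk, mul_one] at this
  · have hadm : Admissible (T.gam α k) (T.nbr k) (T.gam α) :=
      admissible_total (fun x hx => hr.prob_pos hx) hk
    refine hadm.tendsto_root (hγ k) (fun j _ => hγ j) (isRoot_reach hα hk (reach_pos hα k)) ?_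
    filter_upwards [hadm.eventually (hγ k) fun j _ => hγ j] with γ h
    exact isRoot_rootSol hk h

theorem exists_alphaHat_le_one {α : T.E → ℝ} (hα : ∀ e, 0 < α e ∧ α e < 1) :
    ∃ ε > 0, ∀ n : T.Outcome → ℕ, (∀ x ∈ T.Omega, |T.pHat n x - T.prob α x| < ε) →
      (∀ x ∈ T.Omega, 0 < n x) ∧ ∀ e, T.alphaHat n e ≤ 1 := by
  have hP : α ∈ T.Param := fun e => ⟨(hα e).1, (hα e).2.le⟩
  have hr := regular_of_lt_one hα
  have hlim := tendsto_rootSol hP hr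
  -- At the true `gam α` this quotient equals `α T.CD`, which is less than 1.
  have h1 : ∀ᶠ γ in 𝓝 (T.gam α), T.rootSol γ T.C * T.rootSol γ T.D / γ T.C ≤ 1 := by
    have h := ((hlim T.C).mul (hlim T.D)).div ((continuous_apply T.C).tendsto (T.gam α))
      (by rw [gam_eq]; exact (mul_pos (reach_pos hP _) (beta_pos_le hP _).1).ne')
    rw [reach_mul_reach_div hP] at h
    exact (h.eventually (gt_mem_nhds (hα _).2)).mono fun γ h => le_of_lt h
  have h2 : ∀ᶠ γ in 𝓝 (T.gam α), ∀ k ∈ T.inner,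
      T.rootSol γ k / T.rootSol γ (T.par k) ≤ 1 := by
    refine (Finset.eventually_all T.inner).2 fun k hk => ?_
    have hpos := (reach_pos hP (T.par k)).ne'
    have h := (hlim k).div (hlim (T.par k)) hpos
    rw [reach_out α (out_par hk), mul_div_cancel_right₀ _ hpos] at h
    exact (h.eventually (gt_mem_nhds (hα _).2)).mono fun γ h => le_of_lt h
  obtain ⟨δ, hδ, hball⟩ := Metric.eventually_nhds_iff.1 (h1.and h2)
  obtain ⟨x₀, hx₀, hmin⟩ := Finset.exists_min_image T.Omega (T.prob α) ⟨0, zero_mem_omega⟩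
  have hcard : (0 : ℝ) < T.Omega.card := by
    exact_mod_cast Finset.card_pos.2 ⟨0, zero_mem_omega (T := T)⟩
  -- The smallest outcome probability excludes zero counts; the second bound, summed over `Omega`,
  -- stays strictly below `δ` because of the added 1.
  refine ⟨min (T.prob α x₀) (δ / (T.Omega.card + 1)),
    lt_min (hr.prob_pos hx₀) (by positivity), fun n hn => ?_⟩
  have hdist : dist (T.total (T.pHat n)) (T.gam α) < δ := by
    rw [dist_pi_lt_iff hδ]
    intro k
    rw [Real.dist_eq, total, gam, ← Finset.sum_sub_distrib]
    calc |∑ x ∈ T.OmegaAt k, (T.pHat n x - T.prob α x)|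
        ≤ ∑ x ∈ T.OmegaAt k, |T.pHat n x - T.prob α x| := Finset.abs_sum_le_sum_abs _ _
      _ ≤ ∑ x ∈ T.Omega, |T.pHat n x - T.prob α x| :=
        Finset.sum_le_sum_of_subset_of_nonneg (omegaAt_subset k) fun _ _ _ => abs_nonneg _
      _ ≤ ∑ x ∈ T.Omega, δ / (T.Omega.card + 1) :=
        Finset.sum_le_sum fun x hx => ((hn x hx).trans_le (min_le_right _ _)).le
      _ < δ := by
        rw [Finset.sum_const, nsmul_eq_mul, mul_div_assoc', div_lt_iff₀ (by positivity)]
        nlinarith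
  obtain ⟨h3, h4⟩ := hball hdist
  refine ⟨fun x hx => ?_, fun e => ?_⟩
  -- A zero count gives `pHat n x = 0`, also when all counts vanish, since division by zero yields
  -- 0.
  · rw [Nat.pos_iff_ne_zero]
    intro h0
    have h5 := (hn x hx).trans_le (min_le_left _ _)
    rw [pHat, h0, Nat.cast_zero, zero_div, zero_sub, abs_neg,
      abs_of_pos (hr.prob_pos hx)] at h5
    exact absurd (hmin x hx) (not_le.2 h5)
  · rcases eq_CD_or_exists_lk e with rfl | ⟨p, k, h, rfl⟩
    · rw [alphaHat_CD]
      exact h3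
    · rw [h.alphaHat_lk, ← h.par_eq]
      exact h4 k (mem_inner.2 ⟨p, h⟩)

end

end TreeNetwork

theorem mainTheorem9 {V : Type*} [Fintype V] (T : TreeNetwork V) :
    (∀ n : T.Outcome → ℕ, (∀ x ∈ T.Omega, 0 < n x) →
      T.gammaR n T.C = T.gammaM n T.D ∧
      T.gammaM n T.D = 1 - T.pHat n 0 ∧
      (∀ k, T.Upper k → ¬ T.IsSource k → ∃! A, T.IsRootR n k A) ∧
      (∀ k, T.Lower k → ¬ T.IsReceiver k → ∃! A, T.IsRootM n k A) ∧
      (∀ α, T.SolvesLikelihoodEq n α →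
        T.IsMLE n α ∧ α T.CD = T.AHatR n T.C * T.AHatM n T.D / T.gammaR n T.C) ∧
      ((∀ e, T.alphaHat n e ≤ 1) →
        T.SolvesLikelihoodEq n (T.alphaHat n) ∧
        T.IsMLE n (T.alphaHat n) ∧
        ∀ α, T.IsMLE n α →
          α T.CD = T.AHatR n T.C * T.AHatM n T.D / T.gammaR n T.C)) ∧
    (∀ α : T.E → ℝ, (∀ e, 0 < α e ∧ α e < 1) →
      ∃ ε > 0, ∀ n : T.Outcome → ℕ, (∀ x ∈ T.Omega, |T.pHat n x - T.prob α x| < ε) →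
        (∀ x ∈ T.Omega, 0 < n x) ∧ ∀ e, T.alphaHat n e ≤ 1) := by
  refine ⟨fun n hn => ⟨?_, ?_, fun k hk hs => ?_, fun k hk hs => ?_, fun α h => ?_, fun h => ?_⟩,
    fun α hα => TreeNetwork.exists_alphaHat_le_one hα⟩
  · rw [TreeNetwork.upper_C.gammaR_eq, TreeNetwork.lower_D.gammaM_eq, TreeNetwork.total_D]
  · rw [TreeNetwork.lower_D.gammaM_eq, TreeNetwork.total_D, TreeNetwork.total_C_pHat hn]
  · rw [hk.isRootR_eq]
    exact (TreeNetwork.admissible_pHat hn (mt hk.leaf_iff.1 hs)).existsUnique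
  · rw [hk.isRootM_eq]
    exact (TreeNetwork.admissible_pHat hn (mt hk.leaf_iff.1 hs)).existsUnique
  · have hr := TreeNetwork.regular_of_prob_pos h.1 h.2.1
    have hg := TreeNetwork.gam_eq_of_solvesLikelihoodEq hn h
    exact ⟨TreeNetwork.isMLE_of_gam_eq hn h.1 hr hg,
      TreeNetwork.apply_CD_of_gam_eq h.1 hr hg⟩
  · have hα := TreeNetwork.alphaHat_mem_param hn h
    have hr := TreeNetwork.regular_alphaHat hn
    have hg := TreeNetwork.gam_alphaHat hn
    refine ⟨TreeNetwork.solvesLikelihoodEq_of_gam_eq hn hα hr hg,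
      TreeNetwork.isMLE_of_gam_eq hn hα hr hg, fun α hM => ?_⟩
    obtain ⟨hr', hg'⟩ := TreeNetwork.gam_eq_of_isMLE hn hα hr hg hM
    exact TreeNetwork.apply_CD_of_gam_eq hM.1 hr' hg'
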